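/- **Setting.** Fix a finite alphabet $\Sigma$ and an integer $K\ge 1$. A timed word is a finite sequence $(\sigma_1,t_1)\dots(\sigma_n,t_n)$ with $\sigma_i\in\Sigma$ and $0\le t_1\le\dots\le t_n$ real; a timed language is a set of timed words. The clock $x_\sigma$ ($\sigma\in\Sigma$) has at position $i$ the value $v_i(x_\sigma)=t_i-t_j$, where $j<i$ is the last earlier position with $\sigma_j=\sigma$ ($t_j:=0$ if there is none). A $K$-constraint is a conjunction of constraints $x=c$, $x\in(c,d)$, $x>K$ with integers $0\le c,d\le K$. A simple $K$-constraint consists of exactly one constraint $x=c$ ($0\le c\le K$), $x\in(d,d+1)$ ($0\le d<K$) or $x>K$ for every clock $x$; $\mathrm{Reg}$ is the set of these. A $K$-ERA is $A=(Q,q_{\rm init},E,F)$ with $Q$ finite, $q_{\rm init}\in Q$, $F\subseteq Q$, and $E$ a set of transitions $(q,\sigma,g,q')$ with $g$ a $K$-constraint; it accepts a timed word if there are states $q_{\rm init}=q_0,\dots,q_n\in F$ and transitions $(q_{i-1},\sigma_i,g_i,q_i)\in E$ with $v_i\models g_i$. $L^{\sf tw}(A)$ is the set of accepted timed words. $A$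 is a $K$-DERA if any two distinct transitions from the same state on the same letter have disjoint guards. A region word is a word $w=(\sigma_1,r_1)\dots(\sigma_n,r_n)$ over $\Sigma\times\mathrm{Reg}$; $[\![w]\!]$ is the set of timed words with letters $\sigma_1,\dots,\sigma_n$ and $v_i\models r_i$ for all $i$; $w$ is consistent if $[\![w]\!]\ne\emptyset$. For a timed language $L$ with complement $\overline L$, $\mathrm{RW}(L)$ is the set of consistent $w$ with $[\![w]\!]\subseteq L$. A DFA (its transition function may be partial) over $\Sigma\times\mathrm{Reg}$ is read as a $K$-ERA by using each letter $(\sigma,r)$ as letter $\sigma$ with guard $r$. A 3DFA $D$ is a total deterministic automaton over $\Sigma\times\mathrm{Reg}$ with states labelled $1$, $0$ or $?$; $D(w)$ is the label reached on $w$; $D^+$ and $D^-$ are the DFAs whose accepting states are those labelled $1$ and $0$, respectively. A DFA $C$ is consistent with $D$ if $D(w)=1\Rightarrow w\in L(C)$ and $D(w)=0\Rightarrow w\notin L(C)$. $D$ is complete w.r.t. $L$ if $L^{\sf tw}(D^+)\subseteq L$ and $L^{\sf tw}(D^-)\subseteq\overline L$, and strongly complete if moreover $L(D^+)$ and $L(D^-)$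 contain only consistent words. **The algorithm tLSep** on $L$. It keeps finite sets $S,E$ of region words, initially both $\{\varepsilon\}$, and the table of the values $T(se)$ and $T(sae)$ ($s\in S$, $a\in\Sigma\times\mathrm{Reg}$, $e\in E$), where $T(w)=\,?$ if $w$ is inconsistent, and otherwise a membership query to the Teacher gives $T(w)=1$ if $[\![w]\!]\subseteq L$ and $T(w)=0$ if not. The row of $w$ is $e\mapsto T(we)$. It repeats: 1. *Table.* As long as some $sa$ has a row different from the rows of all elements of $S$, add such an $sa$ to $S$; as long as there are $s_1,s_2\in S$ with equal rows and $a,e$ with $T(s_1ae)\ne T(s_2ae)$, add such an $ae$ to $E$. When neither is possible, let $D_i$ be the 3DFA whose states are the rows of elements of $S$, with initial state the row of $\varepsilon$, transitions $\mathrm{row}(s)\xrightarrow{a}\mathrm{row}(sa)$, and label of $\mathrm{row}(s)$ equal to $T(s)$. 2. *Check.* Check whether $D_i$ is complete (or, in another variant, strongly complete). If not, obtain a counterexample $w$: a consistent $w\in L(D_i^+)\setminus \mathrm{RW}(L)$ or $w\in L(D_i^-)\setminus\mathrm{RW}(\overline L)$, or, in the strong variant, possibly an inconsistent $w\in L(D_i^+)\cup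 L(D_i^-)$. Then add all prefixes of $w$ to $S$ (or, in another variant, add to $E$ a witnessing suffix of $w$: a word $v$ such that $w=uav$ and $T(sav)\ne T(s'v)$ for some $s,s'\in S$ whose rows are the states of $D_i$ reached on $u$ and $ua$). Go to 1. 3. *Candidate.* Choose a DFA $C_i$ consistent with $D_i$. Variants: (a) any consistent DFA; (b) a consistent DFA with the least number of states among all consistent DFAs; (c) the following heuristic. Let $B$ be the set of pairs $(q,q')$ of states of $D_i$ with labels $1$ and $0$; as long as possible, add to $B$ one new pair $(q_1,q_2)$ whose successors on some letter form a pair in $B$. Start with the family consisting of the set of all states of $D_i$; as long as a member $U$ of the family contains both $q,q'$ for some $(q,q')\in B$, remove $U$ and add each of $U\setminus\{q\}$, $U\setminus\{q'\}$ that is contained in no other member. The members of the final family are the states of $C_i$; the initial state is a member of largest cardinality containing the initial state of $D_i$; the successor of $U$ on $a$ is a member of largest cardinality containing all $a$-successors of elements of $U$; a member is accepting if it contains a state labelled $1$. 4. *Comparison.* Ask the Teacher whether $L^{\sf tw}(C_i)\subseteq L$ and $L\subseteq L^{\sf tw}(C_i)$. If both hold, return $C=C_i$. Otherwise the Teacher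 gives a consistent region word $w$ in $L(C_i)\setminus\mathrm{RW}(L)$ or in $\mathrm{RW}(L)\setminus L(C_i)$; add all prefixes of $w$ to $S$ and go to 1. **Theorem.** Let $L$ be a timed language over $\Sigma$ that is recognized by some $K$-ERA. Then for every variant of tLSep: 1. tLSep terminates on $L$: whatever counterexamples the Teacher gives and whatever choices are made, no run is infinite, and no run gets stuck before an automaton is returned. 2. Every automaton $C$ that it returns, read as a $K$-ERA, is a $K$-DERA and satisfies $L^{\sf tw}(C)=L$. 3. If strong completeness of every $D_i$ is checked and every $C_i$ is a consistent DFA with the least number of states (variant (b)), then the returned $C$ has the minimum number of states among all $K$-DERAs recognizing $L$. -/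

import Mathlib

open scoped NNReal

namespace TLSep

/-! ### Constraints over event-recording clocks

The alphabet is `α`; the clock `x_σ` is identified with the letter `σ : α`. -/

/-- A valuation of the event-recording clocks. -/
abbrev Valuation (α : Type) : Type := α → ℝ≥0

/-- Atomic `K`-constraints `x = c`, `x ∈ (c, d)`, `x > K`, with `c, d ∈ {0, …, K}`. -/
inductive Atomic (α : Type) (K : ℕ) : Type
  | eq (x : α) (c : Fin (K + 1))
  | ioo (x : α) (c d : Fin (K + 1))
  | gt (x : α)

/-- Satisfaction of an atomic constraint. -/
def Atomic.Sat {α : Type} {K : ℕ} (v : Valuation α) : Atomic α K → Prop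
  | .eq x c => v x = ((c : ℕ) : ℝ≥0)
  | .ioo x c d => ((c : ℕ) : ℝ≥0) < v x ∧ v x < ((d : ℕ) : ℝ≥0)
  | .gt x => (K : ℝ≥0) < v x

/-- A `K`-constraint is the conjunction of a set of atomic `K`-constraints (for a finite alphabet
there are only finitely many of these, so the conjunction is finite); `∅` is `⊤`. -/
abbrev Constraint (α : Type) (K : ℕ) : Type := Set (Atomic α K)

/-- A valuation satisfies a constraint if it satisfies all its conjuncts. -/
def Constraint.Sat {α : Type} {K : ℕ} (v : Valuation α) (g : Constraint α K) : Prop :=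
  ∀ c ∈ g, c.Sat v

/-- Elementary `K`-constraints on one clock: `x = c` for `c ≤ K`, `x ∈ (d, d + 1)` for
`d + 1 ≤ K`, and `x > K`. -/
inductive Elementary (K : ℕ) : Type
  | eq (c : Fin (K + 1))
  | unit (d : Fin K)
  | gt
  deriving DecidableEq

/-- An elementary constraint, imposed on the clock `x`, as an atomic constraint. -/
def Elementary.toAtomic {α : Type} {K : ℕ} (x : α) : Elementary K → Atomic α K
  | .eq c => .eq x c
  | .unit d => .ioo x d.castSucc d.succ
  | .gt => .gt x

/-- `Reg(Σ, K)`: simple `K`-constraints, one elementary constraint for each clock. -/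
abbrev Region (α : Type) (K : ℕ) : Type := α → Elementary K

/-- A simple constraint as a constraint. -/
def Region.toConstraint {α : Type} {K : ℕ} (r : Region α K) : Constraint α K :=
  Set.range fun x => (r x).toAtomic x

/-! ### Timed words, clocked words, region words -/

/-- Timed words: finite sequences of letters with nondecreasing time stamps in `ℝ≥0`. -/
abbrev TimedWord (α : Type) : Type :=
  {w : List (α × ℝ≥0) // (w.map Prod.snd).Pairwise (· ≤ ·)}

/-- The clocked word of a sequence of time-stamped letters, where `last σ` is the time of the most
recent occurrence of `σ` so far (`0` if there is none). The clock `x_σ` has the value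
`t - last σ`; no truncation occurs as time stamps are nondecreasing. -/
def clockedFrom {α : Type} [DecidableEq α] (last : α → ℝ≥0) :
    List (α × ℝ≥0) → List (α × Valuation α)
  | [] => []
  | (a, t) :: w => (a, fun s => t - last s) :: clockedFrom (Function.update last a t) w

/-- The clocked word of a timed word. -/
def clocked {α : Type} [DecidableEq α] (w : TimedWord α) : List (α × Valuation α) :=
  clockedFrom (fun _ => 0) w.1

/-- Letters of region words. -/
abbrev Letter (α : Type) (K : ℕ) : Type := α × Region α K

/-- Region words over `(Σ, K)`. -/
abbrev RegionWord (α : Type) (K : ℕ) : Type := List (Letter α K)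

/-- The set of timed words compatible with a region word. -/
def sem {α : Type} [DecidableEq α] {K : ℕ} (w : RegionWord α K) : Set (TimedWord α) :=
  {tw | List.Forall₂ (fun c l => c.1 = l.1 ∧ (Region.toConstraint l.2).Sat c.2) (clocked tw) w}

/-- `RegL(Σ, K)`: the consistent region words. -/
def RegL (α : Type) [DecidableEq α] (K : ℕ) : Set (RegionWord α K) := {w | (sem w).Nonempty}

/-- The `K`-region language of a timed language. -/
def RW {α : Type} [DecidableEq α] (K : ℕ) (L : Set (TimedWord α)) : Set (RegionWord α K) :=
  {w | w ∈ RegL α K ∧ sem w ⊆ L}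

/-! ### Event-recording automata -/

/-- A `K`-event-recording automaton. -/
structure ERA (α : Type) (K : ℕ) : Type 1 where
  Q : Type
  finite : Finite Q
  init : Q
  edges : Set (Q × α × Constraint α K × Q)
  accept : Set Q

namespace ERA

variable {α : Type} {K : ℕ}

/-- There is a run over the given clocked word between two states. -/
def Run (A : ERA α K) : A.Q → List (α × Valuation α) → A.Q → Prop
  | p, [], q => p = q
  | p, (a, v) :: w, q =>
      ∃ (g : Constraint α K) (p' : A.Q), (p, a, g, p') ∈ A.edges ∧ g.Sat v ∧ A.Run p' w q

/-- The timed language of an event-recording automaton. -/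
def timedLang [DecidableEq α] (A : ERA α K) : Set (TimedWord α) :=
  {tw | ∃ q ∈ A.accept, A.Run A.init (clocked tw) q}

/-- `K`-DERA: distinct transitions from the same state on the same letter have disjoint guards. -/
def IsDeterministic (A : ERA α K) : Prop :=
  ∀ q a g₁ q₁ g₂ q₂, (q, a, g₁, q₁) ∈ A.edges → (q, a, g₂, q₂) ∈ A.edges →
    (g₁, q₁) ≠ (g₂, q₂) → {v | Constraint.Sat v g₁} ∩ {v | Constraint.Sat v g₂} = ∅

/-- The number of states. -/
noncomputable def numStates (A : ERA α K) : ℕ := Nat.card A.Q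

end ERA

/-! ### DFAs with partial transition function, and 3DFAs -/

/-- A deterministic finite automaton with a partial transition function. -/
structure PDFA (β : Type) : Type 1 where
  Q : Type
  finite : Finite Q
  init : Q
  step : Q → β → Option Q
  accept : Set Q

namespace PDFA

variable {β : Type}

/-- The state reached on a word, if the run exists. -/
def run (C : PDFA β) (w : List β) : Option C.Q :=
  w.foldl (fun o b => o.bind fun q => C.step q b) (some C.init)

/-- The language of a DFA. -/
def lang (C : PDFA β) : Set (List β) := {w | ∃ q ∈ C.accept, C.run w = some q}

/-- The number of states. -/
noncomputable def numStates (C : PDFA β) : ℕ := Nat.card C.Q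

variable {α : Type} {K : ℕ}

/-- A DFA over `Σ × Reg(Σ, K)` interpreted as an event-recording automaton. -/
def toERA (C : PDFA (Letter α K)) : ERA α K where
  Q := C.Q
  finite := C.finite
  init := C.init
  edges := {e | ∃ r : Region α K, e.2.2.1 = r.toConstraint ∧ C.step e.1 (e.2.1, r) = some e.2.2.2}
  accept := C.accept

/-- The timed language of a DFA over `Σ × Reg(Σ, K)`. -/
def timedLang [DecidableEq α] (C : PDFA (Letter α K)) : Set (TimedWord α) := C.toERA.timedLang

/-- The consistent region words accepted by a DFA over `Σ × Reg(Σ, K)`. -/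
def regionLang [DecidableEq α] (C : PDFA (Letter α K)) : Set (RegionWord α K) :=
  C.lang ∩ RegL α K

end PDFA

/-- The values `1`, `0`, `?`. -/
inductive Verdict : Type
  | yes
  | no
  | dontCare

/-- A 3DFA; the partition of its states is given by the function `out`. -/
structure TDFA (β : Type) : Type 1 where
  Q : Type
  finite : Finite Q
  init : Q
  step : Q → β → Q
  out : Q → Verdict

namespace TDFA

variable {β : Type}

/-- The state reached on a word. -/
def run (D : TDFA β) (w : List β) : D.Q := w.foldl D.step D.init

/-- The function from words to `{0, 1, ?}` defined by a 3DFA. -/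
def eval (D : TDFA β) (w : List β) : Verdict := D.out (D.run w)

/-- The DFA `D⁺`. -/
def pos (D : TDFA β) : PDFA β where
  Q := D.Q
  finite := D.finite
  init := D.init
  step := fun q b => some (D.step q b)
  accept := {q | D.out q = .yes}

/-- The DFA `D⁻`. -/
def neg (D : TDFA β) : PDFA β where
  Q := D.Q
  finite := D.finite
  init := D.init
  step := fun q b => some (D.step q b)
  accept := {q | D.out q = .no}

/-- The DFA `C` is consistent with the 3DFA `D`. -/
def ConsistentWith (C : PDFA β) (D : TDFA β) : Prop :=
  ∀ w, (D.eval w = .no → w ∉ C.lang) ∧ (D.eval w = .yes → w ∈ C.lang)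

/-- The DFA `C` is consistent with `D` and has the least number of states among such DFAs. -/
def MinimalConsistentWith (C : PDFA β) (D : TDFA β) : Prop :=
  ConsistentWith C D ∧ ∀ C' : PDFA β, ConsistentWith C' D → C.numStates ≤ C'.numStates

variable {α : Type} [DecidableEq α] {K : ℕ}

/-- Completeness of a 3DFA with respect to a timed language. -/
def Complete (D : TDFA (Letter α K)) (L : Set (TimedWord α)) : Prop :=
  D.pos.timedLang ⊆ L ∧ D.neg.timedLang ⊆ Lᶜ

/-- Strong completeness of a 3DFA with respect to a timed language. -/
def StronglyComplete (D : TDFA (Letter α K)) (L : Set (TimedWord α)) : Prop :=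
  (D.pos.timedLang ⊆ L ∧ D.pos.lang = D.pos.regionLang) ∧
    (D.neg.timedLang ⊆ Lᶜ ∧ D.neg.lang = D.neg.regionLang)

/-- A consistent region word showing that `D` is not complete. -/
def CompletenessCex (D : TDFA (Letter α K)) (L : Set (TimedWord α)) (w : RegionWord α K) : Prop :=
  (w ∈ D.pos.regionLang ∧ w ∉ RW K L) ∨ (w ∈ D.neg.regionLang ∧ w ∉ RW K Lᶜ)

/-- A region word showing that `D` is not strongly complete: a counterexample to completeness, or
an inconsistent region word that is strongly accepted or strongly rejected. -/
def StrongCompletenessCex (D : TDFA (Letter α K)) (L : Set (TimedWord α))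
    (w : RegionWord α K) : Prop :=
  D.CompletenessCex L w ∨ (w ∉ RegL α K ∧ (w ∈ D.pos.lang ∨ w ∈ D.neg.lang))

end TDFA

/-! ### Observation tables -/

open Classical in
/-- The table entry of a region word. The Teacher is asked a membership query ("is `sem w ⊆ L`?")
for consistent words only; inconsistent words get the value `?`. -/
noncomputable def entry {α : Type} [DecidableEq α] {K : ℕ} (L : Set (TimedWord α))
    (w : RegionWord α K) : Verdict :=
  if w ∈ RegL α K then (if sem w ⊆ L then .yes else .no) else .dontCare

/-- The sets of prefixes and suffixes of an observation table; its entries are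
`entry L (s ++ e)`. -/
structure Table (α : Type) (K : ℕ) : Type where
  S : Finset (RegionWord α K)
  E : Finset (RegionWord α K)
  nil_mem_S : [] ∈ S
  nil_mem_E : [] ∈ E

namespace Table

variable {α : Type} [DecidableEq α] {K : ℕ}

/-- The initial observation table. -/
def initial (α : Type) (K : ℕ) : Table α K where
  S := {[]}
  E := {[]}
  nil_mem_S := by simp
  nil_mem_E := by simp

/-- Add a prefix to the table. -/
def addPrefix [Fintype α] (t : Table α K) (s : RegionWord α K) : Table α K where
  S := insert s t.S
  E := t.E
  nil_mem_S := Finset.mem_insert_of_mem t.nil_mem_S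
  nil_mem_E := t.nil_mem_E

/-- Add all prefixes of a word to the set of prefixes of the table. -/
def addPrefixes [Fintype α] (t : Table α K) (w : RegionWord α K) : Table α K where
  S := t.S ∪ w.inits.toFinset
  E := t.E
  nil_mem_S := Finset.mem_union_left _ t.nil_mem_S
  nil_mem_E := t.nil_mem_E

/-- Add a suffix to the table. -/
def addSuffix [Fintype α] (t : Table α K) (e : RegionWord α K) : Table α K where
  S := t.S
  E := insert e t.E
  nil_mem_S := t.nil_mem_S
  nil_mem_E := Finset.mem_insert_of_mem t.nil_mem_E

/-- The row of a region word. -/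
noncomputable def row (L : Set (TimedWord α)) (t : Table α K) (w : RegionWord α K) :
    {e // e ∈ t.E} → Verdict :=
  fun e => entry L (w ++ e.1)

/-- The table is closed. -/
def Closed (L : Set (TimedWord α)) (t : Table α K) : Prop :=
  ∀ s ∈ t.S, ∀ a : Letter α K, ∃ s' ∈ t.S, t.row L s' = t.row L (s ++ [a])

/-- The table is consistent. -/
def Consistent (L : Set (TimedWord α)) (t : Table α K) : Prop :=
  ∀ s₁ ∈ t.S, ∀ s₂ ∈ t.S, t.row L s₁ = t.row L s₂ →
    ∀ a : Letter α K, t.row L (s₁ ++ [a]) = t.row L (s₂ ++ [a])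

/-- The rows of the prefixes in the table. -/
abbrev Rows (L : Set (TimedWord α)) (t : Table α K) : Type :=
  {r : {e // e ∈ t.E} → Verdict // ∃ s ∈ t.S, t.row L s = r}

theorem finite_rows (L : Set (TimedWord α)) (t : Table α K) : Finite (t.Rows L) := by
  have h : (t.S : Set (RegionWord α K)).Finite := t.S.finite_toSet
  exact ((h.image (t.row L)).subset (by rintro r ⟨s, hs, rfl⟩; exact ⟨s, hs, rfl⟩)).to_subtype

/-- The 3DFA of a closed (and consistent) table: the states are the rows of the prefixes, the
initial state is the row of the empty word, the letter `a` leads from the row of `s` to the row of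
`s ++ [a]` (consistency makes this independent of the choice of `s`), and the value of a row is its
entry at the empty suffix. -/
noncomputable def hypothesis (L : Set (TimedWord α)) (t : Table α K) (h : t.Closed L) :
    TDFA (Letter α K) where
  Q := t.Rows L
  finite := t.finite_rows L
  init := ⟨t.row L [], [], t.nil_mem_S, rfl⟩
  step := fun r a =>
    ⟨t.row L (r.2.choose ++ [a]), h r.2.choose r.2.choose_spec.1 a⟩
  out := fun r => r.1 ⟨[], t.nil_mem_E⟩

/-- `v` is a witnessing suffix of the word `w` (as in the method of Rivest and Schapire):
`w = u a v`, and if `s` and `s'` are prefixes in the table whose rows are the states reached on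
`u` and on `u a`, then the entries of `s a v` and `s' v` differ. -/
def WitnessingSuffix (L : Set (TimedWord α)) (t : Table α K) (h : t.Closed L)
    (w v : RegionWord α K) : Prop :=
  ∃ (u : RegionWord α K) (a : Letter α K) (s s' : RegionWord α K),
    w = u ++ a :: v ∧ s ∈ t.S ∧ s' ∈ t.S ∧
    t.row L s = (show t.Rows L from (t.hypothesis L h).run u).1 ∧
    t.row L s' = (show t.Rows L from (t.hypothesis L h).run (u ++ [a])).1 ∧
    entry L (s ++ a :: v) ≠ entry L (s' ++ v)

end Table

/-! ### The heuristic that computes a small DFA consistent with a 3DFA -/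

namespace Heuristic

variable {β : Type}

/-- The pairs with which the computation of the incompatible pairs starts. -/
def initialBad (D : TDFA β) : Set (D.Q × D.Q) := {p | D.out p.1 = .yes ∧ D.out p.2 = .no}

/-- The pair `p` can be added to the set `bad` of incompatible pairs. -/
def CanAdd (D : TDFA β) (bad : Set (D.Q × D.Q)) (p : D.Q × D.Q) : Prop :=
  p ∉ bad ∧ ∃ b : β, (D.step p.1 b, D.step p.2 b) ∈ bad

/-- The set `T` of the family `good` is split at the pair `p`: it is replaced by those of
`T \ {p.1}` and `T \ {p.2}` that are not contained in another member of the family. -/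
def split {Q : Type} (good : Set (Set Q)) (T : Set Q) (p : Q × Q) : Set (Set Q) :=
  (good \ {T}) ∪
    {U | (U = T \ {p.1} ∨ U = T \ {p.2}) ∧ ¬ ∃ T' ∈ good \ {T}, U ⊆ T'}

/-- `T` has the largest cardinality among the members of `good` that contain `U`. -/
def LargestContaining {Q : Type} (good : Set (Set Q)) (U T : Set Q) : Prop :=
  T ∈ good ∧ U ⊆ T ∧ ∀ T' ∈ good, U ⊆ T' → T'.ncard ≤ T.ncard

/-- The DFA built from the final family `good` and a choice of the initial state and of the
targets of the transitions. -/
def candidate (D : TDFA β) (good : Set (Set D.Q)) (i : good) (δ : good → β → good) : PDFA β where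
  Q := good
  finite := by
    have := D.finite
    exact inferInstance
  init := i
  step := fun T b => some (δ T b)
  accept := {T | ∃ q ∈ T.1, D.out q = .yes}

/-- The choices permitted in the construction of the DFA. -/
def Admissible (D : TDFA β) (good : Set (Set D.Q)) (i : good) (δ : good → β → good) : Prop :=
  LargestContaining good {D.init} i.1 ∧
    ∀ (T : good) (b : β), LargestContaining good ((fun q => D.step q b) '' T.1) (δ T b).1

end Heuristic

/-! ### The algorithm -/

/-- Which check the 3DFAs have to pass. -/
inductive CheckMode : Type
  | complete
  | stronglyComplete

/-- How a counterexample to (strong) completeness is used: its prefixes become prefixes of the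
table, or a witnessing suffix of it becomes a suffix of the table. -/
inductive CexMode : Type
  | prefixes
  | witnessingSuffix

/-- How the DFA is extracted from the 3DFA: an arbitrary consistent DFA, the DFA computed by the
heuristic, or a consistent DFA with the least number of states. -/
inductive CandidateMode : Type
  | anyConsistent
  | heuristic
  | minimal

/-- The variants of the algorithm. -/
structure Variant : Type where
  check : CheckMode
  cex : CexMode
  candidate : CandidateMode

/-- The check passes. -/
def CheckMode.Passes {α : Type} [DecidableEq α] {K : ℕ} :
    CheckMode → TDFA (Letter α K) → Set (TimedWord α) → Prop
  | .complete, D, L => D.Complete L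
  | .stronglyComplete, D, L => D.StronglyComplete L

/-- Counterexamples to the check. -/
def CheckMode.Cex {α : Type} [DecidableEq α] {K : ℕ} :
    CheckMode → TDFA (Letter α K) → Set (TimedWord α) → RegionWord α K → Prop
  | .complete, D, L, w => D.CompletenessCex L w
  | .stronglyComplete, D, L, w => D.StrongCompletenessCex L w

/-- Configurations of the algorithm on the timed language `L`. -/
inductive Config {α : Type} [DecidableEq α] (K : ℕ) (L : Set (TimedWord α)) : Type 1
  /-- The table is being made closed and consistent. -/
  | filling (t : Table α K)
  /-- The 3DFA of the table `t` is about to be checked for (strong) completeness. -/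
  | checking (t : Table α K) (h : t.Closed L)
  /-- A DFA has to be extracted from the 3DFA `D`, which passed the check. -/
  | extracting (t : Table α K) (D : TDFA (Letter α K))
  /-- Heuristic: the incompatible pairs of states are being computed. -/
  | pairing (t : Table α K) (D : TDFA (Letter α K)) (bad : Set (D.Q × D.Q))
  /-- Heuristic: the maximal compatible sets of states are being computed. -/
  | splitting (t : Table α K) (D : TDFA (Letter α K)) (bad : Set (D.Q × D.Q))
      (good : Set (Set D.Q))
  /-- The candidate `C` is about to be compared with `L`. -/
  | comparing (t : Table α K) (C : PDFA (Letter α K))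
  /-- The algorithm has terminated and has returned `C`. -/
  | returned (C : PDFA (Letter α K))

/-- The steps of the algorithm. They leave open the choices of the learner (such as the order in
which defects of the table are treated) and the counterexamples chosen by the Teacher. -/
inductive Step {α : Type} [Fintype α] [DecidableEq α] {K : ℕ} (V : Variant)
    (L : Set (TimedWord α)) : Config K L → Config K L → Prop
  /-- Repair a table that is not closed. -/
  | close (t : Table α K) (s : RegionWord α K) (a : Letter α K) (hs : s ∈ t.S)
      (h : ∀ s' ∈ t.S, t.row L s' ≠ t.row L (s ++ [a])) :
      Step V L (.filling t) (.filling (t.addPrefix (s ++ [a])))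
  /-- Repair a table that is not consistent. -/
  | separate (t : Table α K) (s₁ s₂ : RegionWord α K) (a : Letter α K) (e : RegionWord α K)
      (h₁ : s₁ ∈ t.S) (h₂ : s₂ ∈ t.S) (he : e ∈ t.E) (hrow : t.row L s₁ = t.row L s₂)
      (hne : entry L (s₁ ++ a :: e) ≠ entry L (s₂ ++ a :: e)) :
      Step V L (.filling t) (.filling (t.addSuffix (a :: e)))
  /-- The table is closed and consistent: pass to its 3DFA. -/
  | hypothesize (t : Table α K) (hcl : t.Closed L) (hco : t.Consistent L) :
      Step V L (.filling t) (.checking t hcl)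
  /-- The check fails, and the prefixes of the counterexample are added to the table. -/
  | refutePrefixes (t : Table α K) (h : t.Closed L) (w : RegionWord α K)
      (hV : V.cex = .prefixes) (hw : V.check.Cex (t.hypothesis L h) L w) :
      Step V L (.checking t h) (.filling (t.addPrefixes w))
  /-- The check fails, and a witnessing suffix of the counterexample is added to the table. -/
  | refuteSuffix (t : Table α K) (h : t.Closed L) (w v : RegionWord α K)
      (hV : V.cex = .witnessingSuffix) (hw : V.check.Cex (t.hypothesis L h) L w)
      (hv : t.WitnessingSuffix L h w v) :
      Step V L (.checking t h) (.filling (t.addSuffix v))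
  /-- The check succeeds. -/
  | pass (t : Table α K) (h : t.Closed L) (hp : V.check.Passes (t.hypothesis L h) L) :
      Step V L (.checking t h) (.extracting t (t.hypothesis L h))
  /-- Extract an arbitrary consistent DFA. -/
  | extractAny (t : Table α K) (D : TDFA (Letter α K)) (C : PDFA (Letter α K))
      (hV : V.candidate = .anyConsistent) (hC : TDFA.ConsistentWith C D) :
      Step V L (.extracting t D) (.comparing t C)
  /-- Extract a consistent DFA with the least number of states. -/
  | extractMinimal (t : Table α K) (D : TDFA (Letter α K)) (C : PDFA (Letter α K))
      (hV : V.candidate = .minimal) (hC : TDFA.MinimalConsistentWith C D) :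
      Step V L (.extracting t D) (.comparing t C)
  /-- Start the heuristic. -/
  | startHeuristic (t : Table α K) (D : TDFA (Letter α K)) (hV : V.candidate = .heuristic) :
      Step V L (.extracting t D) (.pairing t D (Heuristic.initialBad D))
  /-- Add an incompatible pair. -/
  | addPair (t : Table α K) (D : TDFA (Letter α K)) (bad : Set (D.Q × D.Q)) (p : D.Q × D.Q)
      (hp : Heuristic.CanAdd D bad p) :
      Step V L (.pairing t D bad) (.pairing t D (insert p bad))
  /-- No pair can be added. -/
  | pairsDone (t : Table α K) (D : TDFA (Letter α K)) (bad : Set (D.Q × D.Q))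
      (h : ∀ p, ¬ Heuristic.CanAdd D bad p) :
      Step V L (.pairing t D bad) (.splitting t D bad {Set.univ})
  /-- Split a set that contains an incompatible pair. -/
  | splitSet (t : Table α K) (D : TDFA (Letter α K)) (bad : Set (D.Q × D.Q))
      (good : Set (Set D.Q)) (T : Set D.Q) (p : D.Q × D.Q) (hT : T ∈ good) (hp : p ∈ bad)
      (h₁ : p.1 ∈ T) (h₂ : p.2 ∈ T) :
      Step V L (.splitting t D bad good) (.splitting t D bad (Heuristic.split good T p))
  /-- No set contains an incompatible pair: build the DFA. -/
  | splitDone (t : Table α K) (D : TDFA (Letter α K)) (bad : Set (D.Q × D.Q))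
      (good : Set (Set D.Q)) (h : ∀ T ∈ good, ∀ p ∈ bad, ¬ (p.1 ∈ T ∧ p.2 ∈ T))
      (i : good) (δ : good → Letter α K → good) (hδ : Heuristic.Admissible D good i δ) :
      Step V L (.splitting t D bad good) (.comparing t (Heuristic.candidate D good i δ))
  /-- The Teacher finds a consistent region word on which the candidate is wrong. -/
  | refuteCandidate (t : Table α K) (C : PDFA (Letter α K)) (w : RegionWord α K)
      (hw : (w ∈ C.regionLang ∧ w ∉ RW K L) ∨ (w ∈ RW K L ∧ w ∉ C.lang)) :
      Step V L (.comparing t C) (.filling (t.addPrefixes w))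
  /-- The Teacher answers both inclusion queries positively. -/
  | accept (t : Table α K) (C : PDFA (Letter α K)) (h₁ : C.timedLang ⊆ L) (h₂ : L ⊆ C.timedLang) :
      Step V L (.comparing t C) (.returned C)

/-- The initial configuration. -/
def Config.start {α : Type} [DecidableEq α] (K : ℕ) (L : Set (TimedWord α)) :
    Config K L :=
  .filling (Table.initial α K)

/-- The configuration `c` can occur in a run of the algorithm. -/
def Reachable {α : Type} [Fintype α] [DecidableEq α] {K : ℕ} (V : Variant)
    (L : Set (TimedWord α)) (c : Config K L) : Prop :=
  Relation.ReflTransGen (Step V L) (Config.start K L) c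

/-- The algorithm terminates: there is no infinite run, whatever choices are made, and a run that
cannot be continued has returned an automaton. -/
def Terminates {α : Type} [Fintype α] [DecidableEq α] (K : ℕ) (V : Variant)
    (L : Set (TimedWord α)) : Prop :=
  (¬ ∃ f : ℕ → Config K L, f 0 = Config.start K L ∧ ∀ n, Step V L (f n) (f (n + 1))) ∧
    ∀ c : Config K L, Reachable V L c → (∀ c', ¬ Step V L c c') → ∃ C, c = .returned C

/-- `C` is an automaton that the algorithm can return. -/
def Returns {α : Type} [Fintype α] [DecidableEq α] {K : ℕ} (V : Variant)
    (L : Set (TimedWord α)) (C : PDFA (Letter α K)) : Prop :=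
  Reachable V L (.returned C)

end TLSep

/-! Regions partition the valuations and no `K`-guard splits a region. So every timed word has
exactly one region word, an ERA treats a timed word as a subset automaton treats its region word
(`ERA.run_iff`), and membership in `L` depends on the region word alone. A DFA over region letters
accepts a timed word iff it accepts its region word.

Termination rests on a Myhill–Nerode bound: only finitely many functions `v ↦ entry L (u ++ v)`
occur (`finite_range_residual`). Such a residual is determined by the ERA states reachable on `u`,
which settle acceptance, and by the clock classes reachable on `u`, which settle consistency because
clock equivalence is a time-abstract bisimulation (`exists_delay`). Every change of the table raises
`Table.progress`, a sum of three counts, each at most the number of residuals. Closing adds a row;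
separating and witnessing suffixes split rows; the prefixes of a word on which the 3DFA is wrong add
a residual, since the 3DFA is right whenever the residuals of all prefixes are represented in the
table (`Table.eval_eq_entry`). A counterexample to a candidate is also a word on which the 3DFA is
wrong, as the candidate is consistent with it. Between changes of the table the phases only advance,
and each loop of the heuristic has its own decreasing measure.

Every configuration other than a returned one has a successor: failed checks yield counterexamples,
these have witnessing suffixes, `D⁺` is a consistent DFA, and the heuristic keeps every compatible
set covered. Correctness is the Teacher's last answer.

For minimality, a `K`-DERA becomes a DFA on the same states by refining guards to regions. Under
strong completeness every DFA for `L` is consistent with the 3DFA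
(`consistentWith_of_stronglyComplete`), so it competes with the minimal candidate. -/

namespace TLSep

/-! ### Regions partition the valuations -/

section Regions

variable {α : Type} {K : ℕ}

/-- The values of a clock that satisfy an elementary constraint. -/
def Elementary.Holds (t : ℝ≥0) : Elementary K → Prop
  | .eq c => t = ((c : ℕ) : ℝ≥0)
  | .unit d => ((d : ℕ) : ℝ≥0) < t ∧ t < ((d : ℕ) : ℝ≥0) + 1
  | .gt => (K : ℝ≥0) < t

theorem Elementary.sat_toAtomic (v : Valuation α) (x : α) (e : Elementary K) :
    (e.toAtomic x).Sat v ↔ e.Holds (v x) := by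
  cases e <;> simp [Elementary.toAtomic, Atomic.Sat, Elementary.Holds]

theorem Elementary.exists_holds (K : ℕ) (t : ℝ≥0) : ∃ e : Elementary K, e.Holds t := by
  by_cases h : (K : ℝ≥0) < t
  · exact ⟨.gt, h⟩
  have hle : ((⌊t⌋₊ : ℕ) : ℝ≥0) ≤ t := Nat.floor_le zero_le
  have hlt : t < ((⌊t⌋₊ : ℕ) : ℝ≥0) + 1 := Nat.lt_floor_add_one t
  push Not at h
  have hK : ⌊t⌋₊ ≤ K := by exact_mod_cast hle.trans h
  rcases hle.eq_or_lt with heq | hlt'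
  · exact ⟨.eq ⟨⌊t⌋₊, by omega⟩, heq.symm⟩
  · have : ⌊t⌋₊ < K := by exact_mod_cast hlt'.trans_le h
    exact ⟨.unit ⟨⌊t⌋₊, this⟩, hlt', hlt⟩

theorem Elementary.holds_unique {t : ℝ≥0} {e e' : Elementary K} (h : e.Holds t)
    (h' : e'.Holds t) : e = e' := by
  have key : ∀ m n : ℕ, (m : ℝ≥0) < n + 1 → m ≤ n := fun m n hmn => by
    have : m < n + 1 := by exact_mod_cast hmn
    omega
  rcases e with c | d | _ <;> rcases e' with c' | d' | _ <;> simp only [Elementary.Holds] at h h'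
  · congr 1
    ext
    exact_mod_cast h.symm.trans h'
  · subst h
    have h1 : (d' : ℕ) < c := by exact_mod_cast h'.1
    have h2 := key _ _ h'.2
    omega
  · subst h
    have h1 : K < c := by exact_mod_cast h'
    omega
  · subst h'
    have h1 : (d : ℕ) < c' := by exact_mod_cast h.1
    have h2 := key _ _ h.2
    omega
  · congr 1
    ext
    exact le_antisymm (key _ _ (h.1.trans h'.2)) (key _ _ (h'.1.trans h.2))
  · have h1 := key _ _ (h'.trans h.2)
    omega
  · subst h'
    have h1 : K < c' := by exact_mod_cast h
    omega
  · have h1 := key _ _ (h.trans h'.2)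
    omega
  · rfl

theorem Region.sat_toConstraint {r : Region α K} {v : Valuation α} :
    r.toConstraint.Sat v ↔ ∀ x, (r x).Holds (v x) := by
  simp [Constraint.Sat, Region.toConstraint, Elementary.sat_toAtomic]

/-- The region of a valuation. -/
noncomputable def regionOf (K : ℕ) (v : Valuation α) : Region α K :=
  fun x => (Elementary.exists_holds K (v x)).choose

/-- Exactly one elementary constraint holds of each clock value; satisfaction of a simple constraint
thereby becomes an equation. -/
theorem Region.sat_iff {r : Region α K} {v : Valuation α} :
    r.toConstraint.Sat v ↔ regionOf K v = r := by
  rw [Region.sat_toConstraint]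
  have h : ∀ x, (regionOf K v x).Holds (v x) := fun x =>
    (Elementary.exists_holds K (v x)).choose_spec
  constructor
  · exact fun hr => funext fun x => Elementary.holds_unique (h x) (hr x)
  · rintro rfl
    exact h

theorem regionOf_eq_iff {v v' : Valuation α} :
    regionOf K v = regionOf K v' ↔
      ∀ (x : α) (e : Elementary K), e.Holds (v x) ↔ e.Holds (v' x) := by
  have h : ∀ (v : Valuation α) x, (regionOf K v x).Holds (v x) := fun v x =>
    (Elementary.exists_holds K (v x)).choose_spec
  constructor
  · intro heq x e
    constructor <;> intro he
    · rw [Elementary.holds_unique he (h v x), heq]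
      exact h v' x
    · rw [Elementary.holds_unique he (h v' x), ← heq]
      exact h v x
  · intro heq
    exact funext fun x => Elementary.holds_unique ((heq x _).1 (h v x)) (h v' x)

/-- An elementary constraint describes a point, an open interval between consecutive integers, or
the values beyond `K`; no integer up to `K` cuts it. -/
theorem Elementary.natCast_le_congr {s t : ℝ≥0} {e : Elementary K} (hs : e.Holds s)
    (ht : e.Holds t) {n : ℕ} (hn : n ≤ K) : (n : ℝ≥0) ≤ s ↔ (n : ℝ≥0) ≤ t := by
  have hnK : (n : ℝ≥0) ≤ K := by exact_mod_cast hn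
  rcases e with c | d | _ <;> simp only [Elementary.Holds] at hs ht
  · rw [hs, ht]
  · have key : ∀ u : ℝ≥0, ((d : ℕ) : ℝ≥0) < u → u < (d : ℕ) + 1 → ((n : ℝ≥0) ≤ u ↔ n ≤ d) := by
      intro u h1 h2
      constructor
      · intro h
        have : n < d + 1 := by exact_mod_cast h.trans_lt h2
        omega
      · intro h
        exact le_trans (by exact_mod_cast h) h1.le
    rw [key s hs.1 hs.2, key t ht.1 ht.2]
  · exact iff_of_true (hnK.trans hs.le) (hnK.trans ht.le)

theorem Elementary.le_natCast_congr {s t : ℝ≥0} {e : Elementary K} (hs : e.Holds s)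
    (ht : e.Holds t) {n : ℕ} (hn : n ≤ K) : s ≤ (n : ℝ≥0) ↔ t ≤ (n : ℝ≥0) := by
  have hnK : (n : ℝ≥0) ≤ K := by exact_mod_cast hn
  rcases e with c | d | _ <;> simp only [Elementary.Holds] at hs ht
  · rw [hs, ht]
  · have key : ∀ u : ℝ≥0, ((d : ℕ) : ℝ≥0) < u → u < (d : ℕ) + 1 → (u ≤ (n : ℝ≥0) ↔ d < n) := by
      intro u h1 h2
      constructor
      · intro h
        exact_mod_cast h1.trans_le h
      · intro h
        exact h2.le.trans (by exact_mod_cast h)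
    rw [key s hs.1 hs.2, key t ht.1 ht.2]
  · exact iff_of_false (hnK.trans_lt hs).not_ge (hnK.trans_lt ht).not_ge

/-- Atomic constraints are Boolean combinations of comparisons with integers up to `K`, and these
are constant on regions. -/
theorem Constraint.sat_congr {v v' : Valuation α} (h : regionOf K v = regionOf K v')
    (g : Constraint α K) : g.Sat v ↔ g.Sat v' := by
  refine forall₂_congr fun c _ => ?_
  have hr : ∀ x, (regionOf K v x).Holds (v x) ∧ (regionOf K v x).Holds (v' x) := fun x =>
    ⟨Region.sat_toConstraint.1 (Region.sat_iff.2 rfl) x,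
      Region.sat_toConstraint.1 (Region.sat_iff.2 h.symm) x⟩
  rcases c with ⟨x, c⟩ | ⟨x, c, d⟩ | x
  · simp only [Atomic.Sat, le_antisymm_iff]
    rw [Elementary.natCast_le_congr (hr x).1 (hr x).2 c.is_le,
      Elementary.le_natCast_congr (hr x).1 (hr x).2 c.is_le]
  · simp only [Atomic.Sat, ← not_le]
    rw [Elementary.natCast_le_congr (hr x).1 (hr x).2 d.is_le,
      Elementary.le_natCast_congr (hr x).1 (hr x).2 c.is_le]
  · simp only [Atomic.Sat, ← not_le]
    rw [Elementary.le_natCast_congr (hr x).1 (hr x).2 le_rfl]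

end Regions

/-! ### Region words of timed words -/

section RegionWords

variable {α : Type} {K : ℕ}

/-- The letter of region words that a letter of clocked words is compatible with. -/
noncomputable def letterOf (K : ℕ) (c : α × Valuation α) : Letter α K := (c.1, regionOf K c.2)

/-- The only simple guard that a valuation satisfies is its own region, so each move of the ERA is
the move of the DFA on that region letter. -/
theorem PDFA.toERA_run_iff (C : PDFA (Letter α K)) (p q : C.Q) (w : List (α × Valuation α)) :
    C.toERA.Run p w q ↔
      (w.map (letterOf K)).foldl (fun o b => o.bind fun q => C.step q b) (some p) = some q := by
  induction w generalizing p with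
  | nil => exact Option.some_inj.symm
  | cons c w ih =>
    obtain ⟨a, v⟩ := c
    have hnone : ∀ w : List (Letter α K),
        w.foldl (fun o b => o.bind fun q => C.step q b) none = none := by
      intro w
      induction w <;> simp_all
    simp only [ERA.Run, List.map_cons, List.foldl_cons, Option.bind_some]
    constructor
    · rintro ⟨g, p', ⟨r, hr, hs⟩, hg, hrun⟩
      simp only at hr hs
      subst hr
      rw [Region.sat_iff] at hg
      rw [letterOf, hg, hs]
      exact (ih p').1 hrun
    · intro h
      rcases hs : C.step p (letterOf K (a, v)) with _ | p'
      · rw [hs, hnone] at h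
        cases h
      · exact ⟨_, p', ⟨_, rfl, hs⟩, Region.sat_iff.2 rfl, (ih p').2 (hs ▸ h)⟩

/-- The states reached from a set of states of an event-recording automaton on a letter of
region words. -/
def ERA.post (A : ERA α K) (P : Set A.Q) (l : Letter α K) : Set A.Q :=
  {q | ∃ p ∈ P, ∃ g v, (p, l.1, g, q) ∈ A.edges ∧ regionOf K v = l.2 ∧ g.Sat v}

/-- This is the subset construction. `post` asks for some valuation of the region that satisfies the
guard; the actual one then satisfies it too. -/
theorem ERA.run_iff (A : ERA α K) (P : Set A.Q) (q : A.Q) (w : List (α × Valuation α)) :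
    (∃ p ∈ P, A.Run p w q) ↔ q ∈ (w.map (letterOf K)).foldl A.post P := by
  induction w generalizing P with
  | nil => simp [ERA.Run]
  | cons c w ih =>
    obtain ⟨a, v⟩ := c
    rw [List.map_cons, List.foldl_cons, ← ih]
    constructor
    · rintro ⟨p, hp, g, p', he, hg, hrun⟩
      exact ⟨p', ⟨p, hp, g, v, he, rfl, hg⟩, hrun⟩
    · rintro ⟨p', ⟨p, hp, g, v', he, hr, hg⟩, hrun⟩
      exact ⟨p, hp, g, p', he, (g.sat_congr hr).1 hg, hrun⟩

/-- The region word of a timed word. -/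
noncomputable def wordOf [DecidableEq α] (K : ℕ) (tw : TimedWord α) : RegionWord α K :=
  (clocked tw).map (letterOf K)

variable [DecidableEq α]

theorem mem_sem {tw : TimedWord α} {w : RegionWord α K} : tw ∈ sem w ↔ wordOf K tw = w := by
  rw [wordOf, ← List.forall₂_eq_eq_eq, List.forall₂_map_left_iff]
  simp only [sem, Set.mem_ofPred_eq, Region.sat_iff, letterOf, Prod.ext_iff]

theorem mem_RegL {w : RegionWord α K} : w ∈ RegL α K ↔ ∃ tw, wordOf K tw = w :=
  exists_congr fun _ => mem_sem

theorem wordOf_mem_RegL (tw : TimedWord α) : wordOf K tw ∈ RegL α K := mem_RegL.2 ⟨tw, rfl⟩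

theorem PDFA.mem_timedLang (C : PDFA (Letter α K)) (tw : TimedWord α) :
    tw ∈ C.timedLang ↔ wordOf K tw ∈ C.lang :=
  exists_congr fun q => and_congr_right fun _ => C.toERA_run_iff C.init q (clocked tw)

/-- An event-recording automaton as an acceptor of region words. -/
def ERA.Accepts (A : ERA α K) (w : RegionWord α K) : Prop :=
  ∃ q ∈ A.accept, q ∈ w.foldl A.post {A.init}

theorem ERA.mem_timedLang (A : ERA α K) (tw : TimedWord α) :
    tw ∈ A.timedLang ↔ A.Accepts (wordOf K tw) := by
  refine exists_congr fun q => and_congr_right fun _ => ?_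
  rw [wordOf, ← A.run_iff]
  simp

/-- A timed language that does not split the sets `sem w`. -/
def RegionClosed (K : ℕ) (L : Set (TimedWord α)) : Prop :=
  ∀ tw tw' : TimedWord α, wordOf K tw = wordOf K tw' → tw ∈ L → tw' ∈ L

theorem ERA.regionClosed (A : ERA α K) : RegionClosed K A.timedLang := by
  intro tw tw' h
  rw [A.mem_timedLang, A.mem_timedLang, h]
  exact id

theorem RegionClosed.sem_subset {L : Set (TimedWord α)} (hL : RegionClosed K L)
    (tw : TimedWord α) : sem (wordOf K tw) ⊆ L ↔ tw ∈ L :=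
  ⟨fun h => h (mem_sem.2 rfl), fun h _ h' => hL _ _ (mem_sem.1 h').symm h⟩

theorem RegionClosed.compl {L : Set (TimedWord α)} (hL : RegionClosed K L) :
    RegionClosed K Lᶜ := fun tw tw' h h1 h2 => h1 (hL tw' tw h.symm h2)

end RegionWords

/-! ### Clock equivalence -/

section ClockEquivalence

/-- Two finite families in a dense order that are ordered in the same way remain so after adding an
element to the first family and a suitable element to the second. -/
theorem exists_same_position {ι : Type*} [Finite ι] (f f' : ι → ℝ)
    (h : ∀ i j, f i ≤ f j ↔ f' i ≤ f' j) (d : ℝ) :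
    ∃ d', ∀ i, (f i ≤ d ↔ f' i ≤ d') ∧ (d ≤ f i ↔ d' ≤ f' i) := by
  classical
  by_cases hd : ∃ i, f i = d
  · obtain ⟨i, rfl⟩ := hd
    exact ⟨f' i, fun j => ⟨h j i, h i j⟩⟩
  push Not at hd
  have := Fintype.ofFinite ι
  -- `ℝ` is dense and has no endpoints, so a separating point exists even if one of the two finite
  -- sets is empty.
  obtain ⟨d', h1, h2⟩ := Order.exists_between_finsets
    (lo := (Finset.univ.filter fun i => f i < d).image f')
    (hi := (Finset.univ.filter fun i => d < f i).image f') (by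
      simp only [Finset.mem_image, Finset.mem_filter, Finset.mem_univ, true_and]
      rintro _ ⟨i, hi, rfl⟩ _ ⟨j, hj, rfl⟩
      rw [← not_le, ← h, not_le]
      exact hi.trans hj)
  simp only [Finset.mem_image, Finset.mem_filter, Finset.mem_univ, true_and,
    forall_exists_index, and_imp, forall_apply_eq_imp_iff₂] at h1 h2
  refine ⟨d', fun i => ?_⟩
  rcases lt_or_gt_of_ne (hd i) with hi | hi
  · exact ⟨iff_of_true hi.le (h1 i hi).le, iff_of_false hi.not_ge (h1 i hi).not_ge⟩
  · exact ⟨iff_of_false hi.not_ge (h2 i hi).not_ge, iff_of_true hi.le (h2 i hi).le⟩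

variable {α : Type} {K : ℕ}

/-- The value of a clock, where `none` is a clock whose value is always `0`. -/
def clockValue (v : Valuation α) : Option α → ℝ≥0
  | none => 0
  | some x => v x

/-- The comparisons of the clocks with values at most `K` with each other and with the integers;
the time-abstract class of a valuation. -/
def clockClass (K : ℕ) (v : Valuation α) :
    Option α → Option α → Fin (K + 1) → Fin (K + 1) → Prop :=
  fun x y m n => clockValue v x ≤ K ∧ clockValue v y ≤ K ∧
    clockValue v x + (m : ℕ) ≤ clockValue v y + (n : ℕ)

/-- The class records this as the comparison `x + 0 ≤ 0 + K` with the constant clock `none`. -/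
theorem clockValue_le_congr {v v' : Valuation α} (h : clockClass K v = clockClass K v')
    (x : Option α) : clockValue v x ≤ K ↔ clockValue v' x ≤ K := by
  have key : ∀ v : Valuation α, clockValue v x ≤ K ↔
      clockClass K v x none 0 (Fin.last K) := fun v => by
    simp [clockClass, clockValue]
  rw [key, key, h]

theorem clockValue_add_le_congr {v v' : Valuation α} (h : clockClass K v = clockClass K v')
    {x y : Option α} (hx : clockValue v x ≤ K) (hy : clockValue v y ≤ K) {m n : ℕ} (hm : m ≤ K)
    (hn : n ≤ K) : clockValue v x + m ≤ clockValue v y + n ↔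
      clockValue v' x + m ≤ clockValue v' y + n := by
  have hx' := (clockValue_le_congr h x).1 hx
  have hy' := (clockValue_le_congr h y).1 hy
  have := iff_of_eq (congr_fun (congr_fun (congr_fun (congr_fun h x) y)
    ⟨m, by omega⟩) ⟨n, by omega⟩)
  simpa [clockClass, hx, hy, hx', hy'] using this

/-- Comparisons with `none` locate a clock among the integers up to `K`. The class is finer than the
region because it also compares clocks with each other. -/
theorem regionOf_congr {v v' : Valuation α} (h : clockClass K v = clockClass K v') :
    regionOf K v = regionOf K v' := by
  rw [regionOf_eq_iff]
  intro x e
  have hK : v x ≤ K ↔ v' x ≤ K := clockValue_le_congr h (some x)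
  by_cases hx : v x ≤ K
  · have hx' := hK.1 hx
    have h1 : ∀ n : ℕ, n ≤ K → (v x ≤ n ↔ v' x ≤ n) := fun n hn => by
      simpa [clockValue] using
        clockValue_add_le_congr h (x := some x) (y := none) hx (by simp [clockValue])
          (Nat.zero_le K) hn
    have h2 : ∀ n : ℕ, n ≤ K → (n ≤ v x ↔ n ≤ v' x) := fun n hn => by
      simpa [clockValue] using
        clockValue_add_le_congr h (x := none) (y := some x) (by simp [clockValue]) hx
          hn (Nat.zero_le K)
    rcases e with c | d | _ <;> simp only [Elementary.Holds]
    · rw [le_antisymm_iff, le_antisymm_iff, h1 c c.is_le, h2 c c.is_le]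
    · have := h2 (d + 1) d.2
      push_cast at this
      rw [← not_le, ← not_le, ← not_le, ← not_le, h1 d d.2.le, this]
    · rw [← not_le, ← not_le, hK]
  · have hx' : ¬ v' x ≤ K := fun h' => hx (hK.2 h')
    push Not at hx hx'
    have key : ∀ t : ℝ≥0, K < t → (e.Holds t ↔ e = .gt) := fun t ht =>
      ⟨fun he => Elementary.holds_unique he (e' := .gt) ht, by rintro rfl; exact ht⟩
    rw [key _ hx, key _ hx']

/-- A reset clock becomes a copy of `none`, so the new class is a reindexing of the old one. -/
theorem clockClass_update [DecidableEq α] {v v' : Valuation α}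
    (h : clockClass K v = clockClass K v') (a : α) :
    clockClass K (Function.update v a 0) = clockClass K (Function.update v' a 0) := by
  have key : ∀ (v : Valuation α) x, clockValue (Function.update v a 0) x =
      clockValue v (if x = some a then none else x) := by
    rintro v (_ | x)
    · simp [clockValue]
    · by_cases hx : x = a
      · subst hx
        simp [clockValue]
      · simp [clockValue, hx]
  funext x y m n
  simp only [clockClass, key]
  exact congr_fun (congr_fun (congr_fun (congr_fun h _) _) m) n

/-- Clock equivalence is a time-abstract bisimulation. -/
theorem exists_delay [Finite α] {v v' : Valuation α} (h : clockClass K v = clockClass K v')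
    (d : ℝ≥0) :
    ∃ d' : ℝ≥0, clockClass K (fun x => v x + d) = clockClass K (fun x => v' x + d') := by
  -- The family consists of the delays `n - x` after which a clock `x ≤ K` reaches the integer `n`.
  -- The clock class fixes their order, and the position of `d` among them decides how `x + d`
  -- compares with `n`.
  let ι := {x : Option α // clockValue v x ≤ K} × Fin (K + 1)
  obtain ⟨e, he⟩ := exists_same_position (ι := ι)
    (fun i => (i.2 : ℝ) - clockValue v i.1) (fun i => (i.2 : ℝ) - clockValue v' i.1) (by
      rintro ⟨⟨x, hx⟩, m⟩ ⟨⟨y, hy⟩, n⟩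
      have := clockValue_add_le_congr h hy hx m.is_le n.is_le
      rw [← NNReal.coe_le_coe, ← NNReal.coe_le_coe] at this
      push_cast at this
      constructor <;> intro h' <;> simp only at h' ⊢
      · linarith [this.1 (by linarith)]
      · linarith [this.2 (by linarith)]) d
  -- The clock `none` with the integer `0` puts `0` into both families, so `0 ≤ d` carries over to
  -- `e`.
  have he0 : 0 ≤ e := by
    have := (he (⟨none, by simp [clockValue]⟩, 0)).1
    simpa [clockValue] using this
  lift e to ℝ≥0 using he0
  refine ⟨e, ?_⟩
  have hle : ∀ (x : α), v x ≤ K → ∀ n : ℕ, n ≤ K → (v x + d ≤ n ↔ v' x + e ≤ n) := by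
    intro x hx n hn
    have := (he (⟨some x, hx⟩, ⟨n, by omega⟩)).2
    simp only [clockValue] at this
    rw [← NNReal.coe_le_coe, ← NNReal.coe_le_coe]
    push_cast
    rwa [← le_sub_iff_add_le', ← le_sub_iff_add_le']
  have hge : ∀ (x : α), v x ≤ K → ∀ n : ℕ, n ≤ K → (n ≤ v x + d ↔ n ≤ v' x + e) := by
    intro x hx n hn
    have := (he (⟨some x, hx⟩, ⟨n, by omega⟩)).1
    simp only [clockValue] at this
    rw [← NNReal.coe_le_coe, ← NNReal.coe_le_coe]
    push_cast
    rwa [← sub_le_iff_le_add', ← sub_le_iff_le_add']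
  have hK : ∀ x : α, v x ≤ K ↔ v' x ≤ K := fun x => clockValue_le_congr h (some x)
  have hK' : ∀ x : α, v x + d ≤ K ↔ v' x + e ≤ K := by
    intro x
    by_cases hx : v x ≤ K
    · exact hle x hx K le_rfl
    · exact iff_of_false (fun h' => hx (le_self_add.trans h'))
        (fun h' => hx ((hK x).2 (le_self_add.trans h')))
  funext x y m n
  rcases x with _ | x <;> rcases y with _ | y <;>
    simp only [clockClass, clockValue, eq_iff_iff, hK']
  -- Here `m ≤ y + n` is the comparison of `y` with the truncated difference `m - n`.
  · refine and_congr_right fun _ => and_congr_right fun hy => ?_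
    have hy : v y ≤ K := (hK y).2 (le_self_add.trans hy)
    have := hge y hy (m - n) ((Nat.sub_le _ _).trans m.is_le)
    push_cast at this
    rwa [tsub_le_iff_right, tsub_le_iff_right, ← zero_add ((m : ℕ) : ℝ≥0)] at this
  · refine and_congr_right fun hx => and_congr_right fun _ => ?_
    have hx : v x ≤ K := (hK x).2 (le_self_add.trans hx)
    -- If `n < m`, then `x + m ≤ n` fails before and after replacing the valuation; otherwise `x` is
    -- compared with `n - m`.
    by_cases hmn : (m : ℕ) ≤ n
    · have := hle x hx (n - m) ((Nat.sub_le _ _).trans n.is_le)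
      have hmn' : ((m : ℕ) : ℝ≥0) ≤ (n : ℕ) := by exact_mod_cast hmn
      push_cast at this
      rwa [le_tsub_iff_right hmn', le_tsub_iff_right hmn', ← zero_add ((n : ℕ) : ℝ≥0)] at this
    · have key : ∀ t : ℝ≥0, ¬ t + (m : ℕ) ≤ 0 + (n : ℕ) := by
        intro t ht
        rw [zero_add] at ht
        exact hmn (by exact_mod_cast le_add_self.trans ht)
      exact iff_of_false (key _) (key _)
  · refine and_congr_right fun hx => and_congr_right fun hy => ?_
    have hx : v x ≤ K := (hK x).2 (le_self_add.trans hx)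
    have hy : v y ≤ K := (hK y).2 (le_self_add.trans hy)
    have := clockValue_add_le_congr h (x := some x) (y := some y) hx hy m.is_le n.is_le
    -- The delay cancels in comparisons between two clocks.
    rw [add_right_comm, add_right_comm (v y), add_right_comm (v' x), add_right_comm (v' y),
      add_le_add_iff_right, add_le_add_iff_right]
    exact this

end ClockEquivalence

/-! ### Table entries have finitely many residuals -/

section Residuals

variable {α : Type} [DecidableEq α] {K : ℕ}

/-- The region word can be read from the given valuation. -/
def Readable : Valuation α → RegionWord α K → Prop
  | _, [] => True
  | v, l :: w => ∃ d : ℝ≥0, regionOf K (fun x => v x + d) = l.2 ∧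
      Readable (Function.update (fun x => v x + d) l.1 0) w

/-- The second valuation can be reached from the first one by reading the region word. -/
def Reaches : Valuation α → RegionWord α K → Valuation α → Prop
  | v, [], v' => v = v'
  | v, l :: w, v' => ∃ d : ℝ≥0, regionOf K (fun x => v x + d) = l.2 ∧
      Reaches (Function.update (fun x => v x + d) l.1 0) w v'

theorem readable_append {v : Valuation α} {u w : RegionWord α K} :
    Readable v (u ++ w) ↔ ∃ v', Reaches v u v' ∧ Readable v' w := by
  induction u generalizing v with
  | nil => simp [Reaches]
  | cons l u ih =>
    simp only [List.cons_append, Readable, ih, Reaches]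
    constructor
    · rintro ⟨d, hd, v', h⟩
      exact ⟨v', ⟨d, hd, h.1⟩, h.2⟩
    · rintro ⟨v', ⟨d, hd, h⟩, h'⟩
      exact ⟨d, hd, v', h, h'⟩

theorem Readable.congr [Finite α] {v v' : Valuation α} (h : clockClass K v = clockClass K v')
    {w : RegionWord α K} (hw : Readable v w) : Readable v' w := by
  induction w generalizing v v' with
  | nil => trivial
  | cons l w ih =>
    obtain ⟨d, hd, hw⟩ := hw
    obtain ⟨d', hd'⟩ := exists_delay h d
    exact ⟨d', (regionOf_congr hd').symm.trans hd, ih (clockClass_update hd' _) hw⟩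

theorem update_sub_last (last : α → ℝ≥0) (t : ℝ≥0) (a : α) :
    Function.update (fun x => t - last x) a 0 = fun x => t - Function.update last a t x := by
  funext x
  by_cases hx : x = a
  · subst hx
    simp
  · simp [hx]

theorem update_last_le {last : α → ℝ≥0} {t : ℝ≥0} (h : ∀ x, last x ≤ t) (a x : α) :
    Function.update last a t x ≤ t := by
  by_cases hx : x = a
  · subst hx
    simp
  · simpa [hx] using h x

/-- Absolute time stamps are translated into delays. The induction needs an arbitrary current time
and arbitrary last occurrences; `hlast` keeps the subtractions from truncating. -/
theorem exists_clockedFrom_iff (w : RegionWord α K) (now : ℝ≥0) (last : α → ℝ≥0)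
    (hlast : ∀ x, last x ≤ now) :
    (∃ l : List (α × ℝ≥0), (l.map Prod.snd).Pairwise (· ≤ ·) ∧ (∀ c ∈ l, now ≤ c.2) ∧
      (clockedFrom last l).map (letterOf K) = w) ↔ Readable (fun x => now - last x) w := by
  induction w generalizing now last with
  | nil =>
    refine iff_of_true ⟨[], ?_⟩ trivial
    simp [clockedFrom]
  | cons r w ih =>
    obtain ⟨a, r⟩ := r
    have hadd : ∀ d, (fun x => now - last x + d) = fun x => now + d - last x := fun d =>
      funext fun x => tsub_add_eq_add_tsub (hlast x)
    simp only [Readable, hadd, update_sub_last]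
    constructor
    · rintro ⟨_ | ⟨⟨b, t⟩, l⟩, hl, hnow, h⟩
      · simp [clockedFrom] at h
      simp only [clockedFrom, List.map_cons, List.cons.injEq, letterOf, Prod.mk.injEq] at h
      obtain ⟨⟨rfl, hr⟩, h⟩ := h
      have ht : now ≤ t := hnow (b, t) List.mem_cons_self
      simp only [List.map_cons, List.pairwise_cons, List.mem_map, forall_exists_index, and_imp,
        forall_apply_eq_imp_iff₂] at hl
      refine ⟨t - now, ?_⟩
      rw [add_tsub_cancel_of_le ht]
      exact ⟨hr, (ih t _ (update_last_le (fun x => (hlast x).trans ht) b)).1 ⟨l, hl.2, hl.1, h⟩⟩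
    · rintro ⟨d, hr, h⟩
      have ht : now ≤ now + d := le_self_add
      obtain ⟨l, hl, hnow, h⟩ := (ih (now + d) _
        (update_last_le (fun x => (hlast x).trans ht) a)).2 h
      refine ⟨(a, now + d) :: l, ?_, ?_, ?_⟩
      · simpa using ⟨fun x b hx => hnow (b, x) hx, hl⟩
      · intro c hc
        rcases List.mem_cons.1 hc with rfl | hc
        · exact ht
        · exact ht.trans (hnow c hc)
      · simp only [clockedFrom, List.map_cons, letterOf, hr]
        exact congrArg _ h

theorem mem_RegL_iff_readable {w : RegionWord α K} :
    w ∈ RegL α K ↔ Readable (fun _ => 0) w := by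
  have := exists_clockedFrom_iff w 0 (fun _ => 0) (fun _ => le_rfl)
  simp only [tsub_self] at this
  rw [← this, mem_RegL]
  constructor
  · rintro ⟨tw, h⟩
    exact ⟨tw.1, tw.2, fun _ _ => zero_le, h⟩
  · rintro ⟨l, hl, -, h⟩
    exact ⟨⟨l, hl⟩, h⟩

/-- The values of the continuations of a region word. -/
noncomputable def residual (L : Set (TimedWord α)) (u : RegionWord α K) :
    RegionWord α K → Verdict :=
  fun v => entry L (u ++ v)

/-- The nonempty set `sem w` is not split by the language, so one member decides for all. -/
theorem sem_subset_timedLang_iff (A : ERA α K) {w : RegionWord α K} (hw : w ∈ RegL α K) :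
    sem w ⊆ A.timedLang ↔ A.Accepts w := by
  obtain ⟨tw, rfl⟩ := mem_RegL.1 hw
  rw [A.regionClosed.sem_subset, A.mem_timedLang]

theorem entry_congr (A : ERA α K) {w w' : RegionWord α K}
    (h : w ∈ RegL α K ↔ w' ∈ RegL α K) (h' : A.Accepts w ↔ A.Accepts w') :
    entry A.timedLang w = entry A.timedLang w' := by
  by_cases hw : w ∈ RegL α K
  · rw [entry, entry, if_pos hw, if_pos (h.1 hw)]
    classical
    refine if_congr ?_ rfl rfl
    rw [sem_subset_timedLang_iff A hw, sem_subset_timedLang_iff A (h.1 hw), h']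
  · simp only [entry, hw, mt h.2 hw, if_false]

theorem finite_range_residual [Finite α] (A : ERA α K) :
    (Set.range (residual (K := K) A.timedLang)).Finite := by
  have := A.finite
  -- This signature takes finitely many values. Its first component decides acceptance of every
  -- continuation, its second whether the continuation stays consistent.
  let sig : RegionWord α K → Set A.Q ×
      Set (Option α → Option α → Fin (K + 1) → Fin (K + 1) → Prop) :=
    fun u => (u.foldl A.post {A.init}, clockClass K '' {v | Reaches (fun _ => 0) u v})
  have hsig : ∀ u u', sig u = sig u' → residual A.timedLang u = residual A.timedLang u' := by
    intro u u' h
    obtain ⟨h1, h2⟩ := Prod.ext_iff.1 h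
    funext v
    refine entry_congr A ?_ ?_
    · have key : ∀ u u', (sig u).2 = (sig u').2 → u ++ v ∈ RegL α K → u' ++ v ∈ RegL α K := by
        intro u u' h huv
        rw [mem_RegL_iff_readable, readable_append] at huv ⊢
        obtain ⟨x, hx, hxv⟩ := huv
        obtain ⟨y, hy, hxy⟩ : clockClass K x ∈ (sig u').2 := h ▸ ⟨x, hx, rfl⟩
        exact ⟨y, hy, hxv.congr hxy.symm⟩
      exact ⟨key u u' h2, key u' u h2.symm⟩
    · simp only [ERA.Accepts, List.foldl_append]
      simp only [sig] at h1
      rw [h1]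
  -- The residual factors through the signature; the default value is used only off the range of
  -- `sig` and plays no role.
  have hfac : residual A.timedLang = Function.extend sig (residual A.timedLang)
      (fun _ _ => Verdict.dontCare) ∘ sig := by
    funext u
    exact (Function.FactorsThrough.extend_apply (fun u u' h => hsig u u' h) _ u).symm
  rw [hfac, Set.range_comp]
  exact (Set.toFinite _).image _

end Residuals

/-! ### Counting the values of a function up to coarsening -/

section Counting

variable {W A B : Type*} [Nonempty W] {f : W → A} {g : W → B} {X Y : Set W}

/-- If `g` is finer than `f`, then `f` is recovered from `g` through any choice of preimages. -/
theorem image_eq_image_image_of_factors (hfg : ∀ x y, g x = g y → f x = f y) :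
    f '' X = (fun b => f (Function.invFun g b)) '' (g '' X) := by
  rw [Set.image_image]
  exact Set.image_congr fun x _ => hfg _ _ (Function.invFun_eq ⟨x, rfl⟩).symm

theorem ncard_image_le_of_factors (hY : (g '' Y).Finite) (hfg : ∀ x y, g x = g y → f x = f y)
    (hXY : X ⊆ Y) : (f '' X).ncard ≤ (g '' Y).ncard := by
  rw [image_eq_image_image_of_factors hfg]
  have h := Set.image_mono (f := g) hXY
  exact (Set.ncard_image_le (hY.subset h)).trans (Set.ncard_le_ncard h hY)

theorem ncard_image_lt_of_new (hY : (g '' Y).Finite) (hfg : ∀ x y, g x = g y → f x = f y)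
    (hXY : X ⊆ Y) {y : W} (hy : y ∈ Y) (hne : ∀ x ∈ X, f x ≠ f y) :
    (f '' X).ncard < (g '' Y).ncard := by
  refine lt_of_lt_of_le (Set.ncard_lt_ncard (t := f '' Y) ⟨Set.image_mono hXY, fun h => ?_⟩ ?_)
    (ncard_image_le_of_factors hY hfg subset_rfl)
  · obtain ⟨x, hx, hxy⟩ := h ⟨y, hy, rfl⟩
    exact hne x hx hxy
  · rw [image_eq_image_image_of_factors hfg]
    exact hY.image _

/-- Equal cardinalities would make the induced map from values of `g` to values of `f` injective on
`X`, but it identifies `g x` and `g y`. -/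
theorem ncard_image_lt_of_split (hY : (g '' Y).Finite) (hfg : ∀ x y, g x = g y → f x = f y)
    (hXY : X ⊆ Y) {x y : W} (hx : x ∈ X) (hy : y ∈ X) (hf : f x = f y) (hg : g x ≠ g y) :
    (f '' X).ncard < (g '' Y).ncard := by
  have h := Set.image_mono (f := g) hXY
  refine lt_of_lt_of_le ?_ (Set.ncard_le_ncard h hY)
  rw [image_eq_image_image_of_factors hfg]
  refine lt_of_le_of_ne (Set.ncard_image_le (hY.subset h)) fun heq => hg ?_
  refine (Set.ncard_image_iff (hY.subset h)).1 heq ⟨x, hx, rfl⟩ ⟨y, hy, rfl⟩ ?_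
  have hinv : ∀ x, f (Function.invFun g (g x)) = f x := fun x =>
    hfg _ _ (Function.invFun_eq ⟨x, rfl⟩)
  simp only [hinv, hf]

end Counting

/-! ### Observation tables -/

instance : Finite Verdict :=
  Finite.of_surjective (fun i : Fin 3 => ![Verdict.yes, .no, .dontCare] i) fun v => by
    cases v
    exacts [⟨0, rfl⟩, ⟨1, rfl⟩, ⟨2, rfl⟩]

section Tables

/-- The prefixes of a table and their extensions by one letter. -/
def Table.extensions {α : Type} {K : ℕ} (t : Table α K) : Set (RegionWord α K) :=
  {w | w ∈ t.S ∨ ∃ s ∈ t.S, ∃ a, w = s ++ [a]}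

theorem Table.extensions_mono {α : Type} {K : ℕ} {t t' : Table α K} (hS : t.S ⊆ t'.S) :
    t.extensions ⊆ t'.extensions := by
  rintro w (hw | ⟨s, hs, a, rfl⟩)
  · exact .inl (hS hw)
  · exact .inr ⟨s, hS hs, a, rfl⟩

variable {α : Type} [DecidableEq α] {K : ℕ} {L : Set (TimedWord α)}

theorem residual_append {u u' : RegionWord α K} (h : residual L u = residual L u')
    (v : RegionWord α K) : residual L (u ++ v) = residual L (u' ++ v) := by
  funext x
  simpa [residual] using congr_fun h (v ++ x)

theorem Table.row_eq_iff {t : Table α K} {u u' : RegionWord α K} :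
    t.row L u = t.row L u' ↔ ∀ e ∈ t.E, entry L (u ++ e) = entry L (u' ++ e) := by
  rw [funext_iff, Subtype.forall]
  rfl

theorem Table.row_eq_of_residual_eq (t : Table α K) {u u' : RegionWord α K}
    (h : residual L u = residual L u') : t.row L u = t.row L u' :=
  Table.row_eq_iff.2 fun e _ => congr_fun h e

theorem TDFA.run_concat {β : Type} (D : TDFA β) (u : List β) (a : β) :
    D.run (u ++ [a]) = D.step (D.run u) a := by
  simp [TDFA.run, List.foldl_append]

theorem TDFA.foldl_pos {β : Type} (D : TDFA β) (q : D.Q) (w : List β) :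
    w.foldl (fun (o : Option D.Q) b => o.bind fun q => some (D.step q b)) (some q) =
      some (w.foldl D.step q) := by
  induction w generalizing q with
  | nil => rfl
  | cons b w ih => exact ih (D.step q b)

theorem TDFA.mem_pos_lang {β : Type} (D : TDFA β) (w : List β) :
    w ∈ D.pos.lang ↔ D.eval w = .yes := by
  have : D.pos.run w = some (D.run w) := D.foldl_pos D.init w
  constructor
  · rintro ⟨q, hq, h⟩
    obtain rfl := Option.some_inj.1 (this.symm.trans h)
    exact hq
  · exact fun h => ⟨_, h, this⟩

theorem TDFA.mem_neg_lang {β : Type} (D : TDFA β) (w : List β) :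
    w ∈ D.neg.lang ↔ D.eval w = .no := by
  have : D.neg.run w = some (D.run w) := D.foldl_pos D.init w
  constructor
  · rintro ⟨q, hq, h⟩
    obtain rfl := Option.some_inj.1 (this.symm.trans h)
    exact hq
  · exact fun h => ⟨_, h, this⟩

/-- The row reached by the 3DFA of the table. -/
noncomputable def Table.runRow (L : Set (TimedWord α)) (t : Table α K) (h : t.Closed L)
    (w : RegionWord α K) : t.Rows L :=
  (t.hypothesis L h).run w

/-- The transition uses a chosen representative of the row; consistency allows it to be exchanged
for `s`. -/
theorem Table.runRow_concat (t : Table α K) (h : t.Closed L) (hc : t.Consistent L)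
    (u : RegionWord α K) (a : Letter α K) {s : RegionWord α K} (hs : s ∈ t.S)
    (hr : t.row L s = (t.runRow L h u).1) :
    (t.runRow L h (u ++ [a])).1 = t.row L (s ++ [a]) := by
  have h1 : t.runRow L h (u ++ [a]) = (t.hypothesis L h).step (t.runRow L h u) a :=
    TDFA.run_concat _ _ _
  rw [h1]
  have h2 := (t.runRow L h u).2.choose_spec
  exact hc _ h2.1 _ hs (h2.2.trans hr.symm) a

theorem Table.eval_eq (t : Table α K) (h : t.Closed L) (w : RegionWord α K) {s : RegionWord α K}
    (hr : t.row L s = (t.runRow L h w).1) : (t.hypothesis L h).eval w = entry L s := by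
  have h1 : (t.hypothesis L h).eval w = (t.runRow L h w).1 ⟨[], t.nil_mem_E⟩ := rfl
  rw [h1, ← hr, Table.row, List.append_nil]

/-- The 3DFA of a closed and consistent table has the correct value on every word whose prefixes
have the same residuals as prefixes in the table. -/
theorem Table.eval_eq_entry (t : Table α K) (h : t.Closed L) (hc : t.Consistent L)
    (w : RegionWord α K)
    (hw : ∀ u ∈ w.inits, ∃ s ∈ t.S, residual L s = residual L u) :
    (t.hypothesis L h).eval w = entry L w := by
  refine t.eval_eq h w ?_
  induction w using List.reverseRecOn with
  | nil => rfl
  | append_singleton u a ih =>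
    have hu : ∀ x ∈ u.inits, ∃ s ∈ t.S, residual L s = residual L x := by
      intro x hx
      rw [List.mem_inits] at hx
      exact hw x ((List.mem_inits _ _).2 (hx.trans (List.prefix_append _ _)))
    obtain ⟨s, hs, hsu⟩ := hu u ((List.mem_inits _ _).2 List.prefix_rfl)
    rw [t.runRow_concat h hc u a hs ((t.row_eq_of_residual_eq hsu).trans (ih hu))]
    exact (t.row_eq_of_residual_eq (residual_append hsu [a])).symm

/-- Every word on which the 3DFA of the table is wrong has a witnessing suffix. -/
theorem Table.exists_witnessingSuffix (t : Table α K) (h : t.Closed L) (w : RegionWord α K)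
    (hw : (t.hypothesis L h).eval w ≠ entry L w) : ∃ v, t.WitnessingSuffix L h w v := by
  by_contra hcon
  push Not at hcon
  -- Replace the part of `w` already read by a prefix from the table that represents the state
  -- reached. Without a witnessing suffix no replacement changes the entry, so at the end of `w` the
  -- 3DFA would be right.
  have key : ∀ u v : RegionWord α K, w = u ++ v →
      ∃ s ∈ t.S, t.row L s = (t.runRow L h u).1 ∧ entry L (s ++ v) = entry L w := by
    intro u
    induction u using List.reverseRecOn with
    | nil =>
      rintro v rfl
      exact ⟨[], t.nil_mem_S, rfl, rfl⟩
    | append_singleton u a ih =>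
      intro v hv
      obtain ⟨s, hs, hsu, hsv⟩ := ih (a :: v) (by simpa using hv)
      obtain ⟨s', hs', hsu'⟩ := (t.runRow L h (u ++ [a])).2
      refine ⟨s', hs', hsu', ?_⟩
      by_contra hne
      exact hcon v ⟨u, a, s, s', by simpa using hv, hs, hs', hsu, hsu',
        fun heq => hne (heq.symm.trans hsv)⟩
  obtain ⟨s, -, hr, he⟩ := key w [] (by simp)
  rw [List.append_nil] at he
  exact hw ((t.eval_eq h w hr).trans he)

/-- The numbers of rows and residuals that the table distinguishes. -/
noncomputable def Table.progress (L : Set (TimedWord α)) (t : Table α K) : ℕ :=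
  (t.row L '' t.S).ncard + (t.row L '' t.extensions).ncard +
    (residual L '' (t.S : Set (RegionWord α K))).ncard

/-- A row is a function of the residual, so each summand is at most the number of residuals. -/
theorem Table.progress_le (hL : (Set.range (residual (K := K) L)).Finite) (t : Table α K) :
    t.progress L ≤ 3 * (Set.range (residual (K := K) L)).ncard := by
  rw [← Set.image_univ] at hL ⊢
  have h1 := ncard_image_le_of_factors hL (fun x y => t.row_eq_of_residual_eq)
    (Set.subset_univ (t.S : Set (RegionWord α K)))
  have h2 := ncard_image_le_of_factors hL (fun x y => t.row_eq_of_residual_eq)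
    (Set.subset_univ t.extensions)
  have h3 := Set.ncard_le_ncard
    (Set.image_mono (f := residual L) (Set.subset_univ (t.S : Set (RegionWord α K)))) hL
  unfold Table.progress
  omega

theorem Table.row_factors {t t' : Table α K} (hE : t.E ⊆ t'.E) (x y : RegionWord α K)
    (h : t'.row L x = t'.row L y) :
    t.row L x = t.row L y :=
  Table.row_eq_iff.2 fun e he => Table.row_eq_iff.1 h e (hE he)

/-- Enlarging the table decreases none of the three counts, so one strict increase suffices. -/
theorem Table.progress_lt {t t' : Table α K} (hS : t.S ⊆ t'.S) (hE : t.E ⊆ t'.E)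
    (h : (t.row L '' t.S).ncard < (t'.row L '' t'.S).ncard ∨
      (t.row L '' t.extensions).ncard < (t'.row L '' t'.extensions).ncard ∨
      (residual L '' (t.S : Set (RegionWord α K))).ncard <
        (residual L '' (t'.S : Set (RegionWord α K))).ncard) :
    t.progress L < t'.progress L := by
  have h1 := ncard_image_le_of_factors (Set.toFinite _) (Table.row_factors (L := L) hE)
    (Finset.coe_subset.2 hS)
  have h2 := ncard_image_le_of_factors (Set.toFinite _) (Table.row_factors (L := L) hE)
    (Table.extensions_mono hS)
  have h3 := ncard_image_le_of_factors ((t'.S.finite_toSet).image (residual L))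
    (fun _ _ h => h) (Finset.coe_subset.2 hS)
  unfold Table.progress
  omega

variable [Fintype α]

theorem Table.progress_lt_close (t : Table α K) {s : RegionWord α K}
    (h : ∀ s' ∈ t.S, t.row L s' ≠ t.row L s) : t.progress L < (t.addPrefix s).progress L := by
  have hS : t.S ⊆ (t.addPrefix s).S := Finset.subset_insert _ _
  refine Table.progress_lt hS subset_rfl (.inl ?_)
  exact ncard_image_lt_of_new (Set.toFinite _) (Table.row_factors subset_rfl)
    (Finset.coe_subset.2 hS) (Finset.mem_coe.2 (Finset.mem_insert_self s t.S)) h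

theorem Table.progress_lt_separate (t : Table α K) {x y e : RegionWord α K}
    (hx : x ∈ t.S) (hy : y ∈ t.S) (hxy : t.row L x = t.row L y)
    (hne : entry L (x ++ e) ≠ entry L (y ++ e)) : t.progress L < (t.addSuffix e).progress L := by
  have hE : t.E ⊆ (t.addSuffix e).E := Finset.subset_insert _ _
  refine Table.progress_lt subset_rfl hE (.inl ?_)
  exact ncard_image_lt_of_split (Set.toFinite _) (Table.row_factors hE) subset_rfl hx hy hxy
    fun h => hne (Table.row_eq_iff.1 h e (Finset.mem_insert_self e t.E))

/-- The words `s ++ [a]` and `s'` share the row reached on `u ++ [a]`, and `v` tells them apart.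
Since `s ++ [a]` need not belong to `S`, the gain is counted among the extensions. -/
theorem Table.progress_lt_witness (t : Table α K) (h : t.Closed L) (hc : t.Consistent L)
    {w v : RegionWord α K} (hv : t.WitnessingSuffix L h w v) :
    t.progress L < (t.addSuffix v).progress L := by
  obtain ⟨u, a, s, s', -, hs, hs', hu, hua, hne⟩ := hv
  have hE : t.E ⊆ (t.addSuffix v).E := Finset.subset_insert _ _
  refine Table.progress_lt subset_rfl hE (.inr (.inl ?_))
  refine ncard_image_lt_of_split (x := s ++ [a]) (y := s') (Set.toFinite _)
    (Table.row_factors hE) subset_rfl (.inr ⟨s, hs, a, rfl⟩) (.inl hs')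
    ((t.runRow_concat h hc u a hs hu).symm.trans hua.symm) fun heq => hne ?_
  simpa using Table.row_eq_iff.1 heq v (Finset.mem_insert_self v t.E)

/-- The added prefixes need not show a new row at once. Some prefix of `w` has a residual not yet
represented, for otherwise the 3DFA would be right on `w`; hence the third summand. -/
theorem Table.progress_lt_counterexample (t : Table α K) (h : t.Closed L) (hc : t.Consistent L)
    {w : RegionWord α K} (hw : (t.hypothesis L h).eval w ≠ entry L w) :
    t.progress L < (t.addPrefixes w).progress L := by
  have hS : t.S ⊆ (t.addPrefixes w).S := Finset.subset_union_left
  refine Table.progress_lt hS subset_rfl (.inr (.inr ?_))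
  have hex : ¬ ∀ u ∈ w.inits, ∃ s ∈ t.S, residual L s = residual L u := fun hall =>
    hw (t.eval_eq_entry h hc w hall)
  push Not at hex
  obtain ⟨u, hu, hne⟩ := hex
  refine ncard_image_lt_of_new (((t.addPrefixes w).S.finite_toSet).image (residual L))
    (fun _ _ h => h) (Finset.coe_subset.2 hS) (y := u) ?_ hne
  exact Finset.mem_coe.2 (Finset.mem_union_right _ (List.mem_toFinset.2 hu))

end Tables

/-! ### The heuristic -/

namespace Heuristic

variable {β : Type} {D : TDFA β}

/-- A set of states that contains no incompatible pair. -/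
def Compatible {Q : Type} (bad : Set (Q × Q)) (U : Set Q) : Prop :=
  ∀ p ∈ bad, ¬ (p.1 ∈ U ∧ p.2 ∈ U)

/-- Every compatible set of states is contained in a member of the family. -/
def Covers {Q : Type} (bad : Set (Q × Q)) (good : Set (Set Q)) : Prop :=
  ∀ U, Compatible bad U → ∃ T ∈ good, U ⊆ T

/-- A compatible subset of the split set misses one end of the bad pair, so it lies in one of the
halves; a discarded half lies in another member. -/
theorem Covers.split {Q : Type} {bad : Set (Q × Q)} {good : Set (Set Q)} (h : Covers bad good)
    {T : Set Q} {p : Q × Q} (hp : p ∈ bad) : Covers bad (split good T p) := by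
  intro U hU
  obtain ⟨T', hT', hUT⟩ := h U hU
  by_cases hT : T' = T
  swap
  · exact ⟨T', .inl ⟨hT', hT⟩, hUT⟩
  subst hT
  obtain ⟨V, hV, hUV⟩ : ∃ V, (V = T' \ {p.1} ∨ V = T' \ {p.2}) ∧ U ⊆ V := by
    by_cases h1 : p.1 ∈ U
    · refine ⟨_, .inr rfl, Set.subset_sdiff_singleton hUT fun h2 => hU p hp ⟨h1, h2⟩⟩
    · exact ⟨_, .inl rfl, Set.subset_sdiff_singleton hUT h1⟩
  by_cases hsub : ∃ T'' ∈ good \ {T'}, V ⊆ T''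
  · obtain ⟨T'', hT'', hV'⟩ := hsub
    exact ⟨T'', .inl hT'', hUV.trans hV'⟩
  · exact ⟨V, .inr ⟨hV, hsub⟩, hUV⟩

/-- Since `bad` is saturated, a bad pair of successors would come from a bad pair in `U`. -/
theorem Compatible.image {bad : Set (D.Q × D.Q)} (hbad : ∀ p, ¬ CanAdd D bad p) {U : Set D.Q}
    (hU : Compatible bad U) (b : β) : Compatible bad ((fun q => D.step q b) '' U) := by
  rintro ⟨_, _⟩ hp ⟨⟨q, hq, rfl⟩, ⟨q', hq', rfl⟩⟩
  by_cases h : (q, q') ∈ bad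
  · exact hU _ h ⟨hq, hq'⟩
  · exact hbad (q, q') ⟨h, b, hp⟩

theorem exists_largestContaining {Q : Type} [Finite Q] {good : Set (Set Q)} {U : Set Q}
    (h : ∃ T ∈ good, U ⊆ T) : ∃ T, LargestContaining good U T := by
  obtain ⟨T, hT, hmax⟩ := Set.exists_max_image {T | T ∈ good ∧ U ⊆ T} Set.ncard (Set.toFinite _) h
  exact ⟨T, hT.1, hT.2, fun T' h1 h2 => hmax T' ⟨h1, h2⟩⟩

/-- Coverage supplies every member that must be chosen: singletons are compatible because `bad`
avoids the diagonal, successor sets because `bad` is saturated. -/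
theorem exists_admissible {bad : Set (D.Q × D.Q)} {good : Set (Set D.Q)}
    (hdiag : ∀ q, (q, q) ∉ bad) (hbad : ∀ p, ¬ CanAdd D bad p) (hcov : Covers bad good)
    (hgood : ∀ T ∈ good, Compatible bad T) : ∃ i δ, Admissible D good i δ := by
  have := D.finite
  obtain ⟨i, hi⟩ := exists_largestContaining (hcov {D.init} (by
    rintro ⟨q, q'⟩ hp ⟨h1, h2⟩
    rw [Set.mem_singleton_iff] at h1 h2
    simp only at h1 h2
    subst h1
    subst h2
    exact hdiag _ hp))
  choose δ hδ using fun (T : good) (b : β) =>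
    exists_largestContaining (hcov _ ((hgood T.1 T.2).image hbad b))
  exact ⟨⟨i, hi.1⟩, fun T b => ⟨δ T b, (hδ T b).1⟩, hi, hδ⟩

/-- The member reached on a word contains the state that `D` reaches. If that state is labelled `0`,
an accepting member would contain a bad pair. -/
theorem candidate_consistentWith {bad : Set (D.Q × D.Q)} {good : Set (Set D.Q)}
    (hinit : initialBad D ⊆ bad) (hgood : ∀ T ∈ good, Compatible bad T) {i : good}
    {δ : good → β → good} (h : Admissible D good i δ) :
    TDFA.ConsistentWith (candidate D good i δ) D := by
  have key : ∀ (w : List β) (q : D.Q) (T : good), q ∈ T.1 →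
      ∃ T' : good, w.foldl (fun (o : Option good) b => o.bind fun T => some (δ T b)) (some T) =
        some T' ∧ w.foldl D.step q ∈ T'.1 := by
    intro w
    induction w with
    | nil => exact fun q T hq => ⟨T, rfl, hq⟩
    | cons b w ih => exact fun q T hq => ih _ _ ((h.2 T b).2.1 ⟨q, hq, rfl⟩)
  intro w
  obtain ⟨T, hT, hq⟩ := key w D.init i (h.1.2.1 rfl)
  have hrun : (candidate D good i δ).run w = some T := hT
  constructor
  · rintro hno ⟨T', ⟨q, hq', hyes⟩, hr⟩
    obtain rfl := Option.some_inj.1 (hrun.symm.trans hr)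
    exact hgood T.1 T.2 (q, D.run w) (hinit ⟨hyes, hno⟩) ⟨hq', hq⟩
  · exact fun hyes => ⟨T, ⟨_, hq, hyes⟩, hrun⟩

/-- A quantity that decreases when a member of the family is split. -/
noncomputable def weight {Q : Type} [Finite Q] (good : Set (Set Q)) : ℕ :=
  ∑ U ∈ good.toFinite.toFinset, 3 ^ U.ncard

theorem weight_split_lt {Q : Type} [Finite Q] {good : Set (Set Q)} {T : Set Q} {p : Q × Q}
    (hT : T ∈ good) (h₁ : p.1 ∈ T) (h₂ : p.2 ∈ T) : weight (split good T p) < weight good := by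
  classical
  have hins : ∀ (s : Finset (Set Q)) (U : Set Q),
      ∑ V ∈ insert U s, 3 ^ V.ncard ≤ 3 ^ U.ncard + ∑ V ∈ s, 3 ^ V.ncard := by
    intro s U
    by_cases hU : U ∈ s
    · rw [Finset.insert_eq_of_mem hU]
      exact Nat.le_add_left _ _
    · rw [Finset.sum_insert hU]
  set G := good.toFinite.toFinset with hG
  have hTG : T ∈ G := by simpa [hG] using hT
  have hsub : (split good T p).toFinite.toFinset ⊆
      insert (T \ {p.1}) (insert (T \ {p.2}) (G.erase T)) := by
    intro U hU
    rw [Set.Finite.mem_toFinset] at hU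
    simp only [Finset.mem_insert, Finset.mem_erase, hG, Set.Finite.mem_toFinset]
    rcases hU with ⟨hU, hne⟩ | ⟨rfl | rfl, -⟩
    · exact .inr (.inr ⟨hne, hU⟩)
    · exact .inl rfl
    · exact .inr (.inl rfl)
  have h1 := Finset.sum_le_sum_of_subset (f := fun U : Set Q => 3 ^ U.ncard) hsub
  have h2 := hins (insert (T \ {p.2}) (G.erase T)) (T \ {p.1})
  have h3 := hins (G.erase T) (T \ {p.2})
  have h4 := Finset.add_sum_erase G (fun U : Set Q => 3 ^ U.ncard) hTG
  -- With base `3`, each half weighs at most a third of `T`, so both together weigh less than `T`.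
  have hpow : ∀ q ∈ T, 3 * 3 ^ (T \ {q}).ncard ≤ 3 ^ T.ncard := by
    intro q hq
    rw [← pow_succ']
    exact Nat.pow_le_pow_right (by norm_num) (Set.ncard_sdiff_singleton_lt_of_mem hq)
  have h5 := hpow _ h₁
  have h6 := hpow _ h₂
  have h7 : 0 < 3 ^ T.ncard := by positivity
  unfold weight
  rw [← hG]
  omega

end Heuristic

/-! ### Deterministic event-recording automata as DFAs -/

section Deterministic

variable {α : Type} {K : ℕ}

theorem PDFA.toERA_isDeterministic (C : PDFA (Letter α K)) : C.toERA.IsDeterministic := by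
  rintro q a g₁ q₁ g₂ q₂ ⟨r₁, hr₁, h₁⟩ ⟨r₂, hr₂, h₂⟩ hne
  simp only at hr₁ hr₂ h₁ h₂
  subst hr₁
  subst hr₂
  rw [Set.eq_empty_iff_forall_notMem]
  rintro v ⟨hv₁, hv₂⟩
  obtain rfl := (Region.sat_iff.1 hv₁).symm.trans (Region.sat_iff.1 hv₂)
  obtain rfl := Option.some_inj.1 (h₁.symm.trans h₂)
  exact hne rfl

open Classical in
/-- The DFA that refines the guards of an event-recording automaton to regions, choosing one
of the successors. -/
noncomputable def ERA.toPDFA (A : ERA α K) : PDFA (Letter α K) where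
  Q := A.Q
  finite := A.finite
  init := A.init
  step := fun q l => if h : (A.post {q} l).Nonempty then some h.some else none
  accept := A.accept

/-- Two edges enabled somewhere in the same region are enabled by a common valuation, because guards
do not split regions; determinism then makes them equal. -/
theorem ERA.IsDeterministic.toPDFA_step {A : ERA α K} (hA : A.IsDeterministic) (p q : A.Q)
    (l : Letter α K) : A.toPDFA.step p l = some q ↔ q ∈ A.post {p} l := by
  have huniq : ∀ q q', q ∈ A.post {p} l → q' ∈ A.post {p} l → q = q' := by
    rintro q q' ⟨_, rfl, g, v, he, hv, hg⟩ ⟨_, rfl, g', v', he', hv', hg'⟩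
    by_contra hne
    have hdis := hA _ _ _ _ _ _ he he' fun h => hne (Prod.ext_iff.1 h).2
    exact Set.eq_empty_iff_forall_notMem.1 hdis v
      ⟨hg, (Constraint.sat_congr (hv.trans hv'.symm) g').2 hg'⟩
  simp only [ERA.toPDFA]
  split_ifs with h
  · rw [Option.some_inj]
    exact ⟨fun heq => heq ▸ h.some_mem, fun hq => huniq _ _ h.some_mem hq⟩
  · exact iff_of_false (by simp) fun hq => h ⟨q, hq⟩

theorem ERA.IsDeterministic.toPDFA_timedLang [DecidableEq α] {A : ERA α K}
    (hA : A.IsDeterministic) : A.toPDFA.timedLang = A.timedLang := by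
  have key : ∀ (w : List (α × Valuation α)) (p q : A.Q),
      A.toPDFA.toERA.Run p w q ↔ A.Run p w q := by
    intro w
    induction w with
    | nil => exact fun _ _ => Iff.rfl
    | cons c w ih =>
      obtain ⟨a, v⟩ := c
      intro p q
      constructor
      · rintro ⟨g, p', ⟨r, hr, hs⟩, hg, hrun⟩
        simp only at hr hs
        subst hr
        obtain ⟨_, rfl, g, v', he, hv', hg'⟩ := (hA.toPDFA_step p p' (a, r)).1 hs
        exact ⟨g, p', he, (g.sat_congr (hv'.trans (Region.sat_iff.1 hg).symm)).1 hg',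
          (ih p' q).1 hrun⟩
      · rintro ⟨g, p', he, hg, hrun⟩
        exact ⟨_, p', ⟨regionOf K v, rfl,
          (hA.toPDFA_step p p' (a, regionOf K v)).2 ⟨p, rfl, g, v, he, rfl, hg⟩⟩,
          Region.sat_iff.2 rfl, (ih p' q).2 hrun⟩
  ext tw
  exact exists_congr fun q => and_congr_right fun _ => key _ _ _

/-- Strong completeness leaves only consistent words with label `1` or `0`, and on these any DFA for
`L` must give the right answer. Its behaviour on inconsistent words is unconstrained. -/
theorem consistentWith_of_stronglyComplete [DecidableEq α] {D : TDFA (Letter α K)}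
    {L : Set (TimedWord α)} (hD : D.StronglyComplete L) {C : PDFA (Letter α K)}
    (hC : C.timedLang = L) : TDFA.ConsistentWith C D := by
  obtain ⟨⟨hpos, hpos'⟩, ⟨hneg, hneg'⟩⟩ := hD
  intro w
  rw [← D.mem_neg_lang, ← D.mem_pos_lang]
  constructor
  · intro hw hwC
    rw [hneg'] at hw
    obtain ⟨tw, rfl⟩ := mem_RegL.1 hw.2
    rw [← PDFA.mem_timedLang, hC] at hwC
    exact hneg ((PDFA.mem_timedLang _ _).2 hw.1) hwC
  · intro hw
    rw [hpos'] at hw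
    obtain ⟨tw, rfl⟩ := mem_RegL.1 hw.2
    rw [← PDFA.mem_timedLang, hC]
    exact hpos ((PDFA.mem_timedLang _ _).2 hw.1)

end Deterministic

/-! ### Answers of the Teacher -/

section Teacher

variable {α : Type} [DecidableEq α] {K : ℕ} {L : Set (TimedWord α)}

theorem entry_eq_yes_iff {w : RegionWord α K} : entry L w = .yes ↔ w ∈ RW K L := by
  simp only [entry, RW]
  split_ifs <;> simp [*]

theorem entry_eq_no_iff {w : RegionWord α K} : entry L w = .no ↔ w ∈ RegL α K ∧ w ∉ RW K L := by
  simp only [entry, RW]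
  split_ifs <;> simp [*]

theorem entry_eq_dontCare_iff {w : RegionWord α K} : entry L w = .dontCare ↔ w ∉ RegL α K := by
  simp only [entry]
  split_ifs with h1 h2 <;> simp [h1]

/-- The timed words of a consistent region word lie all in `L` or all outside it. -/
theorem RegionClosed.mem_RW_compl (hL : RegionClosed K L) {w : RegionWord α K}
    (hw : w ∈ RegL α K) : w ∈ RW K Lᶜ ↔ w ∉ RW K L := by
  obtain ⟨tw, rfl⟩ := mem_RegL.1 hw
  have h1 : wordOf K tw ∈ RW K Lᶜ ↔ tw ∈ Lᶜ :=
    ⟨fun h => (hL.compl.sem_subset tw).1 h.2, fun h => ⟨hw, (hL.compl.sem_subset tw).2 h⟩⟩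
  have h2 : wordOf K tw ∈ RW K L ↔ tw ∈ L :=
    ⟨fun h => (hL.sem_subset tw).1 h.2, fun h => ⟨hw, (hL.sem_subset tw).2 h⟩⟩
  rw [h1, h2, Set.mem_compl_iff]

theorem TDFA.CompletenessCex.eval_ne (hL : RegionClosed K L) {D : TDFA (Letter α K)}
    {w : RegionWord α K} (h : D.CompletenessCex L w) : D.eval w ≠ entry L w := by
  rcases h with ⟨h1, h2⟩ | ⟨h1, h2⟩
  · rw [(D.mem_pos_lang w).1 h1.1, entry_eq_no_iff.2 ⟨h1.2, h2⟩]
    simp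
  · rw [(D.mem_neg_lang w).1 h1.1,
      entry_eq_yes_iff.2 (not_not.1 (mt (hL.mem_RW_compl h1.2).2 h2))]
    simp

theorem CheckMode.Cex.eval_ne (hL : RegionClosed K L) {m : CheckMode} {D : TDFA (Letter α K)}
    {w : RegionWord α K} (h : m.Cex D L w) : D.eval w ≠ entry L w := by
  cases m with
  | complete => exact TDFA.CompletenessCex.eval_ne hL h
  | stronglyComplete =>
    rcases h with h | ⟨h, h' | h'⟩
    · exact h.eval_ne hL
    · rw [(D.mem_pos_lang w).1 h', entry_eq_dontCare_iff.2 h]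
      simp
    · rw [(D.mem_neg_lang w).1 h', entry_eq_dontCare_iff.2 h]
      simp

theorem PDFA.exists_counterexample {C : PDFA (Letter α K)} (h : ¬ C.timedLang ⊆ L) :
    ∃ w ∈ C.regionLang, w ∉ RW K L := by
  obtain ⟨tw, h1, h2⟩ := Set.not_subset.1 h
  exact ⟨wordOf K tw, ⟨(C.mem_timedLang tw).1 h1, wordOf_mem_RegL tw⟩,
    fun h => h2 (h.2 (mem_sem.2 rfl))⟩

theorem PDFA.exists_missing (hL : RegionClosed K L) {C : PDFA (Letter α K)}
    (h : ¬ L ⊆ C.timedLang) : ∃ w ∈ RW K L, w ∉ C.lang := by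
  obtain ⟨tw, h1, h2⟩ := Set.not_subset.1 h
  exact ⟨wordOf K tw, ⟨wordOf_mem_RegL tw, (hL.sem_subset tw).2 h1⟩,
    mt (C.mem_timedLang tw).2 h2⟩

theorem TDFA.exists_completenessCex {D : TDFA (Letter α K)} (h : ¬ D.Complete L) :
    ∃ w, D.CompletenessCex L w := by
  rcases not_and_or.1 h with h | h
  · obtain ⟨w, hw⟩ := PDFA.exists_counterexample h
    exact ⟨w, .inl hw⟩
  · obtain ⟨w, hw⟩ := PDFA.exists_counterexample h
    exact ⟨w, .inr hw⟩

theorem CheckMode.exists_cex {m : CheckMode} {D : TDFA (Letter α K)} (h : ¬ m.Passes D L) :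
    ∃ w, m.Cex D L w := by
  cases m with
  | complete => exact TDFA.exists_completenessCex h
  | stronglyComplete =>
    by_cases hc : D.Complete L
    swap
    · obtain ⟨w, hw⟩ := TDFA.exists_completenessCex hc
      exact ⟨w, .inl hw⟩
    -- A complete 3DFA can fail strong completeness only through an inconsistent word labelled `1`
    -- or `0`.
    by_contra hno
    push Not at hno
    have hreg : ∀ w, w ∈ D.pos.lang ∨ w ∈ D.neg.lang → w ∈ RegL α K := fun w hw =>
      by_contra fun h => hno w (.inr ⟨h, hw⟩)
    exact h ⟨⟨hc.1, (Set.inter_eq_left.2 fun w hw => hreg w (.inl hw)).symm⟩,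
      ⟨hc.2, (Set.inter_eq_left.2 fun w hw => hreg w (.inr hw)).symm⟩⟩

/-- A region word on which a DFA consistent with a 3DFA is wrong is one on which the 3DFA is
wrong. -/
theorem TDFA.ConsistentWith.eval_ne {C : PDFA (Letter α K)} {D : TDFA (Letter α K)}
    (hC : ConsistentWith C D) {w : RegionWord α K}
    (hw : (w ∈ C.regionLang ∧ w ∉ RW K L) ∨ (w ∈ RW K L ∧ w ∉ C.lang)) :
    D.eval w ≠ entry L w := by
  rcases hw with ⟨h1, h2⟩ | ⟨h1, h2⟩
  · rw [entry_eq_no_iff.2 ⟨h1.2, h2⟩]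
    exact fun h => (hC w).1 h h1.1
  · rw [entry_eq_yes_iff.2 h1]
    exact fun h => h2 ((hC w).2 h)

/-- This guarantees that a candidate, and hence a minimal one, always exists. -/
theorem TDFA.consistentWith_pos {β : Type} (D : TDFA β) : ConsistentWith D.pos D := by
  intro w
  rw [D.mem_pos_lang]
  exact ⟨fun h h' => by simp [h] at h', id⟩

theorem TDFA.exists_minimalConsistentWith {β : Type} (D : TDFA β) :
    ∃ C, MinimalConsistentWith C D := by
  classical
  have h : ∃ n, ∃ C : PDFA β, ConsistentWith C D ∧ C.numStates = n :=
    ⟨_, D.pos, D.consistentWith_pos, rfl⟩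
  obtain ⟨C, hC, hn⟩ := Nat.find_spec h
  exact ⟨C, hC, fun C' hC' => hn.trans_le (Nat.find_min' h ⟨C', hC', rfl⟩)⟩

end Teacher

/-! ### Runs of the algorithm -/

section Algorithm

variable {α : Type} [DecidableEq α] {K : ℕ} {L : Set (TimedWord α)} {V : Variant}

/-- `D` is the 3DFA of the closed and consistent table `t` and passes the check. -/
def Checked (V : Variant) (L : Set (TimedWord α)) (t : Table α K) (D : TDFA (Letter α K)) :
    Prop :=
  ∃ h : t.Closed L, t.Consistent L ∧ D = t.hypothesis L h ∧ V.check.Passes D L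

/-- An invariant of the runs of the algorithm. -/
def Config.Invariant (V : Variant) : Config K L → Prop
  | .filling _ => True
  | .checking t _ => t.Consistent L
  | .extracting t D => Checked V L t D
  | .pairing t D bad => Checked V L t D ∧ V.candidate = .heuristic ∧
      Heuristic.initialBad D ⊆ bad ∧ ∀ q, (q, q) ∉ bad
  | .splitting t D bad good => Checked V L t D ∧ V.candidate = .heuristic ∧
      Heuristic.initialBad D ⊆ bad ∧ (∀ q, (q, q) ∉ bad) ∧
      (∀ p, ¬ Heuristic.CanAdd D bad p) ∧ Heuristic.Covers bad good
  | .comparing t C => ∃ D, Checked V L t D ∧ TDFA.ConsistentWith C D ∧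
      (V.candidate = .minimal → TDFA.MinimalConsistentWith C D)
  | .returned C => C.timedLang = L ∧ (V.candidate = .minimal →
      ∃ D : TDFA (Letter α K), V.check.Passes D L ∧ TDFA.MinimalConsistentWith C D)

theorem Step.invariant [Fintype α] {c c' : Config K L} (h : Step V L c c')
    (hc : c.Invariant V) : c'.Invariant V := by
  cases h with
  | close => trivial
  | separate => trivial
  | hypothesize t hcl hco => exact hco
  | refutePrefixes => trivial
  | refuteSuffix => trivial
  | pass t h hp => exact ⟨h, hc, rfl, hp⟩
  | extractAny t D C hV hC => exact ⟨D, hc, hC, fun h => by simp [hV] at h⟩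
  | extractMinimal t D C hV hC => exact ⟨D, hc, hC.1, fun _ => hC⟩
  | startHeuristic t D hV =>
    refine ⟨hc, hV, subset_rfl, ?_⟩
    rintro q ⟨h1, h2⟩
    simp only at h1 h2
    simp [h1] at h2
  | addPair t D bad p hp =>
    obtain ⟨hD, hV, hinit, hdiag⟩ := hc
    refine ⟨hD, hV, hinit.trans (Set.subset_insert _ _), ?_⟩
    rintro q (rfl | hq)
    -- The successors of a diagonal pair are again a diagonal pair, so none becomes bad.
    · obtain ⟨-, b, hb⟩ := hp
      exact hdiag _ hb
    · exact hdiag q hq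
  | pairsDone t D bad h =>
    obtain ⟨hD, hV, hinit, hdiag⟩ := hc
    exact ⟨hD, hV, hinit, hdiag, h, fun U _ => ⟨_, rfl, Set.subset_univ U⟩⟩
  | splitSet t D bad good T p hT hp h₁ h₂ =>
    obtain ⟨hD, hV, hinit, hdiag, hbad, hcov⟩ := hc
    exact ⟨hD, hV, hinit, hdiag, hbad, hcov.split hp⟩
  | splitDone t D bad good h i δ hδ =>
    obtain ⟨hD, hV, hinit, hdiag, hbad, hcov⟩ := hc
    exact ⟨D, hD, Heuristic.candidate_consistentWith hinit h hδ, fun h => by simp [hV] at h⟩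
  | refuteCandidate => trivial
  | accept t C h₁ h₂ =>
    obtain ⟨D, ⟨_, _, _, hD⟩, -, hmin⟩ := hc
    exact ⟨h₁.antisymm h₂, fun hV => ⟨D, hD, hmin hV⟩⟩

theorem Reachable.invariant [Fintype α] {c : Config K L} (h : Reachable V L c) :
    c.Invariant V := by
  induction h with
  | refl => trivial
  | tail _ hs ih => exact hs.invariant ih

/-- A bound on the number of times that the table can still change. -/
noncomputable def Table.remaining (L : Set (TimedWord α)) (t : Table α K) : ℕ :=
  3 * (Set.range (residual (K := K) L)).ncard - t.progress L

/-- The bound on the progress of `t'` ensures that the truncated difference really drops. -/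
theorem Table.remaining_lt (hL : (Set.range (residual (K := K) L)).Finite) {t t' : Table α K}
    (h : t.progress L < t'.progress L) : t'.remaining L < t.remaining L := by
  have := t'.progress_le hL
  unfold Table.remaining
  omega

/-- A rank that decreases in each step of a run. -/
noncomputable def Config.rank : Config K L → ℕ ×ₗ ℕ ×ₗ ℕ
  | .filling t => toLex (t.remaining L, toLex (6, 0))
  | .checking t _ => toLex (t.remaining L, toLex (5, 0))
  | .extracting t _ => toLex (t.remaining L, toLex (4, 0))
  | .pairing t _ bad => toLex (t.remaining L, toLex (3, badᶜ.ncard))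
  | .splitting t D _ good =>
    toLex (t.remaining L, toLex (2, @Heuristic.weight D.Q D.finite good))
  | .comparing t _ => toLex (t.remaining L, toLex (1, 0))
  | .returned _ => toLex (0, toLex (0, 0))

theorem lex_lt_of_fst_lt {a a' : ℕ} (b b' : ℕ ×ₗ ℕ) (h : a < a') :
    (toLex (a, b) : ℕ ×ₗ ℕ ×ₗ ℕ) < toLex (a', b') :=
  Prod.Lex.toLex_lt_toLex.2 (.inl h)

theorem lex_lt_of_snd_lt (a : ℕ) {b b' : ℕ} (c c' : ℕ) (h : b < b') :
    (toLex (a, toLex (b, c)) : ℕ ×ₗ ℕ ×ₗ ℕ) < toLex (a, toLex (b', c')) :=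
  Prod.Lex.toLex_lt_toLex.2 (.inr ⟨rfl, Prod.Lex.toLex_lt_toLex.2 (.inl h)⟩)

theorem lex_lt_of_thd_lt (a b : ℕ) {c c' : ℕ} (h : c < c') :
    (toLex (a, toLex (b, c)) : ℕ ×ₗ ℕ ×ₗ ℕ) < toLex (a, toLex (b, c')) :=
  Prod.Lex.toLex_lt_toLex.2 (.inr ⟨rfl, Prod.Lex.toLex_lt_toLex.2 (.inr ⟨rfl, h⟩)⟩)

/-- Going back to filling requires progress of the table; every other step lowers the phase number
or the measure within a phase. The invariant provides the consistent table behind the 3DFA or the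
candidate. -/
theorem Step.rank_lt [Fintype α] (hL : (Set.range (residual (K := K) L)).Finite)
    (hreg : RegionClosed K L) {c c' : Config K L} (h : Step V L c c') (hc : c.Invariant V) :
    c'.rank < c.rank := by
  cases h with
  | close t s a hs h =>
    exact lex_lt_of_fst_lt _ _ (Table.remaining_lt hL (t.progress_lt_close h))
  | separate t s₁ s₂ a e h₁ h₂ he hrow hne =>
    exact lex_lt_of_fst_lt _ _ (Table.remaining_lt hL (t.progress_lt_separate h₁ h₂ hrow hne))
  | hypothesize => exact lex_lt_of_snd_lt _ _ _ (by norm_num)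
  | refutePrefixes t h w hV hw =>
    exact lex_lt_of_fst_lt _ _
      (Table.remaining_lt hL (t.progress_lt_counterexample h hc (hw.eval_ne hreg)))
  | refuteSuffix t h w v hV hw hv =>
    exact lex_lt_of_fst_lt _ _ (Table.remaining_lt hL (t.progress_lt_witness h hc hv))
  | pass => exact lex_lt_of_snd_lt _ _ _ (by norm_num)
  | extractAny => exact lex_lt_of_snd_lt _ _ _ (by norm_num)
  | extractMinimal => exact lex_lt_of_snd_lt _ _ _ (by norm_num)
  | startHeuristic => exact lex_lt_of_snd_lt _ _ _ (by norm_num)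
  | addPair t D bad p hp =>
    have := D.finite
    refine lex_lt_of_thd_lt _ _ (Set.ncard_lt_ncard ?_ (Set.toFinite _))
    exact compl_lt_compl_iff_lt.2 (Set.ssubset_insert hp.1)
  | pairsDone => exact lex_lt_of_snd_lt _ _ _ (by norm_num)
  | splitSet t D bad good T p hT hp h₁ h₂ =>
    have := D.finite
    exact lex_lt_of_thd_lt _ _ (Heuristic.weight_split_lt hT h₁ h₂)
  | splitDone => exact lex_lt_of_snd_lt _ _ _ (by norm_num)
  | refuteCandidate t C w hw =>
    obtain ⟨_, ⟨h, hco, rfl, -⟩, hC, -⟩ := hc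
    exact lex_lt_of_fst_lt _ _
      (Table.remaining_lt hL (t.progress_lt_counterexample h hco (hC.eval_ne hw)))
  | accept t C h₁ h₂ =>
    -- A returned configuration has rank zero. If the first component is already `0`, the phase
    -- number decreases instead.
    rcases Nat.eq_zero_or_pos (t.remaining L) with h | h
    · simp only [Config.rank, h]
      exact lex_lt_of_snd_lt _ _ _ (by norm_num)
    · exact lex_lt_of_fst_lt _ _ h

theorem exists_step_filling [Fintype α] (t : Table α K) : ∃ c', Step V L (.filling t) c' := by
  by_cases hcl : t.Closed L
  swap
  · unfold Table.Closed at hcl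
    push Not at hcl
    obtain ⟨s, hs, a, h⟩ := hcl
    exact ⟨_, .close t s a hs h⟩
  by_cases hco : t.Consistent L
  · exact ⟨_, .hypothesize t hcl hco⟩
  unfold Table.Consistent at hco
  push Not at hco
  obtain ⟨s₁, h₁, s₂, h₂, hrow, a, h⟩ := hco
  rw [Ne, Table.row_eq_iff] at h
  push Not at h
  obtain ⟨e, he, hne⟩ := h
  rw [List.append_assoc, List.append_assoc] at hne
  exact ⟨_, .separate t s₁ s₂ a e h₁ h₂ he hrow hne⟩

theorem exists_step_checking [Fintype α] (hreg : RegionClosed K L) (t : Table α K)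
    (h : t.Closed L) : ∃ c', Step V L (.checking t h) c' := by
  by_cases hp : V.check.Passes (t.hypothesis L h) L
  · exact ⟨_, .pass t h hp⟩
  obtain ⟨w, hw⟩ := CheckMode.exists_cex hp
  rcases hV : V.cex with _ | _
  · exact ⟨_, .refutePrefixes t h w hV hw⟩
  · obtain ⟨v, hv⟩ := t.exists_witnessingSuffix h w (hw.eval_ne hreg)
    exact ⟨_, .refuteSuffix t h w v hV hw hv⟩

theorem exists_step_extracting [Fintype α] (t : Table α K) (D : TDFA (Letter α K)) :
    ∃ c' : Config K L, Step V L (.extracting t D) c' := by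
  rcases hV : V.candidate with _ | _ | _
  · exact ⟨_, .extractAny t D _ hV D.consistentWith_pos⟩
  · exact ⟨_, .startHeuristic t D hV⟩
  · obtain ⟨C, hC⟩ := D.exists_minimalConsistentWith
    exact ⟨_, .extractMinimal t D C hV hC⟩

theorem exists_step_splitting [Fintype α] (t : Table α K) {D : TDFA (Letter α K)}
    {bad : Set (D.Q × D.Q)} {good : Set (Set D.Q)} (hdiag : ∀ q, (q, q) ∉ bad)
    (hbad : ∀ p, ¬ Heuristic.CanAdd D bad p) (hcov : Heuristic.Covers bad good) :
    ∃ c' : Config K L, Step V L (.splitting t D bad good) c' := by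
  by_cases h : ∀ T ∈ good, Heuristic.Compatible bad T
  · obtain ⟨i, δ, hδ⟩ := Heuristic.exists_admissible hdiag hbad hcov h
    exact ⟨_, .splitDone t D bad good h i δ hδ⟩
  · unfold Heuristic.Compatible at h
    push Not at h
    obtain ⟨T, hT, p, hp, h₁, h₂⟩ := h
    exact ⟨_, .splitSet t D bad good T p hT hp h₁ h₂⟩

theorem exists_step_comparing [Fintype α] (hreg : RegionClosed K L) (t : Table α K)
    (C : PDFA (Letter α K)) : ∃ c' : Config K L, Step V L (.comparing t C) c' := by
  by_cases h₁ : C.timedLang ⊆ L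
  swap
  · obtain ⟨w, hw⟩ := PDFA.exists_counterexample h₁
    exact ⟨_, .refuteCandidate t C w (.inl hw)⟩
  by_cases h₂ : L ⊆ C.timedLang
  · exact ⟨_, .accept t C h₁ h₂⟩
  · obtain ⟨w, hw⟩ := PDFA.exists_missing hreg h₂
    exact ⟨_, .refuteCandidate t C w (.inr hw)⟩

theorem Config.Invariant.exists_step [Fintype α] (hreg : RegionClosed K L) {c : Config K L}
    (hc : c.Invariant V) (h : ∀ C, c ≠ .returned C) : ∃ c', Step V L c c' := by
  cases c with
  | filling t => exact exists_step_filling t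
  | checking t hcl => exact exists_step_checking hreg t hcl
  | extracting t D => exact exists_step_extracting t D
  | pairing t D bad =>
    by_cases hp : ∃ p, Heuristic.CanAdd D bad p
    · obtain ⟨p, hp⟩ := hp
      exact ⟨_, .addPair t D bad p hp⟩
    · exact ⟨_, .pairsDone t D bad (not_exists.1 hp)⟩
  | splitting t D bad good =>
    obtain ⟨-, -, -, hdiag, hbad, hcov⟩ := hc
    exact exists_step_splitting t hdiag hbad hcov
  | comparing t C => exact exists_step_comparing hreg t C
  | returned C => exact absurd rfl (h C)

theorem terminates [Fintype α] (hL : (Set.range (residual (K := K) L)).Finite)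
    (hreg : RegionClosed K L) : Terminates K V L := by
  constructor
  · rintro ⟨f, hf, hstep⟩
    have hinv : ∀ n, (f n).Invariant V := by
      intro n
      induction n with
      | zero => rw [hf]; trivial
      | succ n ih => exact (hstep n).invariant ih
    exact not_strictAnti_of_wellFoundedLT (fun n => (f n).rank)
      (strictAnti_nat_of_succ_lt fun n => (hstep n).rank_lt hL hreg (hinv n))
  · intro c hc hno
    by_contra hret
    obtain ⟨c', h⟩ := hc.invariant.exists_step hreg (not_exists.1 hret)
    exact hno c' h

end Algorithm

end TLSep

theorem mainTheorem1 {α : Type} [Fintype α] [DecidableEq α] (K : ℕ) (hK : 0 < K)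
    (L : Set (TLSep.TimedWord α)) (hL : ∃ A : TLSep.ERA α K, A.timedLang = L)
    (V : TLSep.Variant) :
    TLSep.Terminates K V L ∧
    (∀ C : TLSep.PDFA (TLSep.Letter α K), TLSep.Returns V L C →
      C.toERA.IsDeterministic ∧ C.toERA.timedLang = L) ∧
    (V.check = .stronglyComplete → V.candidate = .minimal →
      ∀ C : TLSep.PDFA (TLSep.Letter α K), TLSep.Returns V L C →
        ∀ A : TLSep.ERA α K, A.IsDeterministic → A.timedLang = L →
          C.toERA.numStates ≤ A.numStates) := by
  obtain ⟨B, rfl⟩ := hL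
  refine ⟨TLSep.terminates (TLSep.finite_range_residual B) B.regionClosed,
    fun C hC => ⟨C.toERA_isDeterministic, (TLSep.Reachable.invariant hC).1⟩, ?_⟩
  intro hcheck hmin C hC A hA hAL
  obtain ⟨D, hD, hCD⟩ := (TLSep.Reachable.invariant hC).2 hmin
  rw [hcheck] at hD
  -- `A.toPDFA` has the states of `A`, so the two state counts agree by definition.
  exact hCD.2 A.toPDFA
    (TLSep.consistentWith_of_stronglyComplete hD (hA.toPDFA_timedLang.trans hAL))
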